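/- Let $K$ be a field and $n\ge 1$. Let $\mathbb L_m=\mathbb L(x_1,\dots,x_m)$ be the free Lie algebra over $K$, and let $\mathfrak P_m$ be the Drinfeld–Kohno Lie algebra, generated by $A_{i,j}$ ($1\le i\ne j\le m$) with relations $A_{i,j}=A_{j,i}$, $[A_{i,k},A_{i,j}+A_{j,k}]=0$, $[A_{i,j},A_{k,l}]=0$ for mutually distinct $i,j,k,l$. Let $\theta\colon\mathfrak P_m\to\mathrm{Der}(\mathbb L_m)$ be given by $\theta(A_{i,j})(x_i)=[x_i,x_j]$, $\theta(A_{i,j})(x_j)=[x_j,x_i]$, $\theta(A_{i,j})(x_k)=0$ for $k\neq i,j$. Let $\mathfrak g$ be a Lie algebra over $K$ with a homomorphism $g\colon\mathfrak g\to\mathfrak P_n$, put $\theta_g=\theta\circ g$, and let $\mathbb L_n\oplus_{\theta_g}\mathfrak g$ be the semidirect sum. It acts on $\mathbb L_{n+1}$ by derivations through $\theta_{\mathrm{id}\oplus g}\colon \mathbb L_n\oplus_{\theta_g}\mathfrak g\to\mathfrak P_{n+1}\xrightarrow{\theta}\mathrm{Der}(\mathbb L_{n+1})$, where $x_i\mapsto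 A_{i,n+1}$ on $\mathbb L_n$ and $\mathfrak g\xrightarrow{g}\mathfrak P_n\subset\mathfrak P_{n+1}$ on $\mathfrak g$. Let $V$ be a finite dimensional $U(\mathbb L_n\oplus_{\theta_g}\mathfrak g)$-module and $\lambda\in K$; write $V^{y}=\{v\in V: yv=0\}$. The middle convolution $\mathfrak{mc}_\lambda(V)$ is the following $U(\mathbb L_n\oplus_{\theta_g}\mathfrak g)$-module. If $\lambda\ne0$, then $$\mathfrak{mc}_\lambda(V)=\mathrm{Coker}\Bigl(\bigoplus_{i=0}^nH_1(\mathbb L(x_i),V\otimes_K K_\lambda)\to H_1(\mathbb L_{n+1},V\otimes_KK_\lambda)\Bigr),$$ where $x_0=-\sum_{i=1}^{n+1}x_i$, and on $V\otimes_KK_\lambda$ the generators $x_1,\dots,x_n$ act through $V$ and $x_{n+1}$ acts as the scalar $\lambda$. The group $H_1(\mathbb L_{n+1},V\otimes_KK_\lambda)$ is regarded as the kernel of $\mathcal I\otimes_{U(\mathbb L_{n+1})}(V\otimes_KK_\lambda)\to V\otimes_KK_\lambda$, $i\otimes v\mapsto iv$, with $\mathcal I$ the augmentation ideal of $U(\mathbb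 L_{n+1})$; here $a\in\mathbb L_n$ acts by $a\cdot(i\otimes v)=\theta_{\mathrm{id}\oplus g}(a)(i)\otimes v$, and $X\in\mathfrak g$ acts by $X\cdot(i\otimes v)=\theta_{\mathrm{id}\oplus g}(X)(i)\otimes v+i\otimes Xv$. If $\lambda=0$, let $M=\bigoplus_{i=1}^nK[x_i,x_{n+1}]\otimes_KV$ with $x_j\cdot([x_i,x_{n+1}]\otimes v)=[x_j,x_{n+1}]\otimes x_iv$ and $X\cdot([x_i,x_{n+1}]\otimes v)=[\theta_g(X)(x_i),x_{n+1}]\otimes v+[x_i,x_{n+1}]\otimes Xv$ for $X\in\mathfrak g$, where $[[a,b],x_{n+1}]\otimes v=[a,x_{n+1}]\otimes bv-[b,x_{n+1}]\otimes av$ for $a,b\in\mathbb L_n$; then $$\mathfrak{mc}_0(V)=M\Big/\Bigl(\sum_{i=1}^nK[x_i,x_{n+1}]\otimes V^{x_i}+M^{\mathbb L_n}\Bigr).$$ Assume that for every $c\in K$ and every $i=1,\dots,n$ $$(*)\quad V^{x_i-c}\cap\bigcap_{j\ne i}V^{x_j}=0,\qquad\qquad(**)\quad (x_i-c)V+\sum_{j\neq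 i}x_jV=V .$$ Then $V$ is irreducible as a $U(\mathbb L_n)$-module if and only if $\mathfrak{mc}_\lambda(V)$ is irreducible as a $U(\mathbb L_n)$-module. In either case both $V$ and $\mathfrak{mc}_\lambda(V)$ are also irreducible as $U(\mathbb L_n\oplus_{\theta_g}\mathfrak g)$-modules. -/

import Mathlib

namespace MidConv

open scoped TensorProduct

noncomputable section

attribute [local instance 100] LieRing.ofAssociativeRing

/-! ### Free Lie algebras and their derivations -/

section Free

variable (K : Type*) [Field K]

/-- The free Lie algebra on `x_1, …, x_n`; the letter `x_{k+1}` is `x K k` with `k : Fin n`. -/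
abbrev L (n : ℕ) : Type _ := FreeLieAlgebra K (Fin n)

/-- The free generators. -/
abbrev x {n : ℕ} (i : Fin n) : L K n := FreeLieAlgebra.of K i

variable {K}

theorem free_induction {X : Type*} {p : FreeLieAlgebra K X → Prop}
    (of : ∀ i, p (FreeLieAlgebra.of K i)) (zero : p 0)
    (add : ∀ a b, p a → p b → p (a + b)) (smul : ∀ (t : K) a, p a → p (t • a))
    (lie : ∀ a b, p a → p b → p ⁅a, b⁆) (a : FreeLieAlgebra K X) : p a := by
  let S : LieSubalgebra K (FreeLieAlgebra K X) :=
    { carrier := {a | p a}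
      add_mem' := fun {a b} ha hb => add a b ha hb
      zero_mem' := zero
      smul_mem' := fun t a ha => smul t a ha
      lie_mem' := fun {a b} ha hb => lie a b ha hb }
  let f : FreeLieAlgebra K X →ₗ⁅K⁆ S := FreeLieAlgebra.lift K fun i => ⟨_, of i⟩
  have h : S.incl.comp f = LieHom.id := by
    ext i
    simp [f]
  have h2 : S.incl (f a) = a := by
    rw [← LieHom.comp_apply, h]; rfl
  rw [← h2]
  exact (f a).2

variable {X : Type*}

/-- Auxiliary representation of the free Lie algebra on `K × FreeLieAlgebra K X`, in which
`x_i (t, m) = (0, t f(x_i) + [x_i, m])`. -/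
def derivAux (f : X → FreeLieAlgebra K X) :
    FreeLieAlgebra K X →ₗ⁅K⁆ Module.End K (K × FreeLieAlgebra K X) :=
  FreeLieAlgebra.lift K fun i =>
    LinearMap.prod 0
      ((LinearMap.toSpanSingleton K _ (f i)).comp (LinearMap.fst K K _)
        + (LieAlgebra.ad K _ (FreeLieAlgebra.of K i)).comp (LinearMap.snd K K _))

theorem derivAux_apply (f : X → FreeLieAlgebra K X) (a : FreeLieAlgebra K X) :
    ∀ u, (derivAux f a u).1 = 0 ∧ derivAux f a (0, u.2) = (0, ⁅a, u.2⁆) := by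
  induction a using free_induction with
  | of i => intro u; simp [derivAux]
  | zero => intro u; simp [Prod.ext_iff]
  | add a b ha hb => intro u; simp [ha, hb]
  | smul t a ha => intro u; simp [ha]
  | lie a b ha hb =>
    intro u
    have ha' := fun m => (ha (0, m)).2
    have hb' := fun m => (hb (0, m)).2
    simp only at ha' hb'
    simp [LieRing.of_associative_ring_bracket, ha, hb, ha', hb']

/-- The derivation of the free Lie algebra with prescribed values on the generators. -/
def derivOf (f : X → FreeLieAlgebra K X) :
    LieDerivation K (FreeLieAlgebra K X) (FreeLieAlgebra K X) where
  toFun a := (derivAux f a (1, 0)).2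
  map_add' a b := by simp
  map_smul' t a := by simp
  leibniz' a b := by
    have h : ∀ a, derivAux f a (1, 0) = (0, (derivAux f a (1, 0)).2) := fun a =>
      Prod.ext (derivAux_apply f a (1, 0)).1 rfl
    have h0 : ∀ a m, derivAux f a (0, m) = (0, ⁅a, m⁆) := fun a m =>
      (derivAux_apply f a (0, m)).2
    change (derivAux f ⁅a, b⁆ (1, 0)).2
      = ⁅a, (derivAux f b (1, 0)).2⁆ - ⁅b, (derivAux f a (1, 0)).2⁆
    rw [LieHom.map_lie, LieRing.of_associative_ring_bracket, LinearMap.sub_apply,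
      Module.End.mul_apply, Module.End.mul_apply, h a, h b, h0, h0]
    rfl

@[simp]
theorem derivOf_of (f : X → FreeLieAlgebra K X) (i : X) :
    derivOf f (FreeLieAlgebra.of K i) = f i := by
  change (derivAux f (FreeLieAlgebra.of K i) (1, 0)).2 = f i
  simp [derivAux]

theorem deriv_ext {D E : LieDerivation K (FreeLieAlgebra K X) (FreeLieAlgebra K X)}
    (h : ∀ i, D (FreeLieAlgebra.of K i) = E (FreeLieAlgebra.of K i)) : D = E := by
  ext a
  induction a using free_induction with
  | of i => exact h i
  | zero => simp
  | add a b ha hb => simp [ha, hb]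
  | smul t a ha => simp [ha]
  | lie a b ha hb => simp [ha, hb]

end Free

/-! ### Drinfeld–Kohno Lie algebras and the infinitesimal braid action -/

section DrinfeldKohno

variable (K : Type*) [Field K] (n : ℕ)

/-- Index set of the generators `A_{i,j}`, `i ≠ j`. -/
abbrev Pair : Type := {p : Fin n × Fin n // p.1 ≠ p.2}

variable {n} in
/-- The letter `A_{i,j}` of the free Lie algebra on all `A_{i,j}`, `i ≠ j`. -/
abbrev preA (i j : Fin n) (h : i ≠ j) : FreeLieAlgebra K (Pair n) :=
  FreeLieAlgebra.of K ⟨(i, j), h⟩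

/-- The infinitesimal braid relators. -/
inductive IsRelator : FreeLieAlgebra K (Pair n) → Prop
  | symm (i j : Fin n) (h : i ≠ j) : IsRelator (preA K i j h - preA K j i h.symm)
  | three (i j k : Fin n) (hij : i ≠ j) (hik : i ≠ k) (hjk : j ≠ k) :
      IsRelator ⁅preA K i k hik, preA K i j hij + preA K j k hjk⁆
  | four (i j k l : Fin n) (hij : i ≠ j) (hik : i ≠ k) (hil : i ≠ l) (hjk : j ≠ k) (hjl : j ≠ l)
      (hkl : k ≠ l) : IsRelator ⁅preA K i j hij, preA K k l hkl⁆

/-- The ideal generated by the infinitesimal braid relators. -/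
def relIdeal : LieIdeal K (FreeLieAlgebra K (Pair n)) :=
  LieSubmodule.lieSpan K (FreeLieAlgebra K (Pair n)) {r | IsRelator K n r}

/-- The Drinfeld–Kohno Lie algebra `𝔓_n`. -/
abbrev DK : Type _ := FreeLieAlgebra K (Pair n) ⧸ relIdeal K n

variable {n} in
/-- The generators `A_{i,j}` of `𝔓_n`. -/
def A (i j : Fin n) (h : i ≠ j) : DK K n := LieSubmodule.Quotient.mk (preA K i j h)

variable {K n}

/-- The homomorphism out of `𝔓_n` attached to elements satisfying the infinitesimal braid
relations. -/
def DK.lift {H : Type*} [LieRing H] [LieAlgebra K H] (f : Pair n → H)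
    (hf : ∀ r, IsRelator K n r → FreeLieAlgebra.lift K f r = 0) : DK K n →ₗ⁅K⁆ H :=
  have hle : ((relIdeal K n : LieIdeal K (FreeLieAlgebra K (Pair n))) :
      Submodule K (FreeLieAlgebra K (Pair n)))
      ≤ LinearMap.ker (FreeLieAlgebra.lift K f : FreeLieAlgebra K (Pair n) →ₗ[K] H) := by
    have h : relIdeal K n ≤ (FreeLieAlgebra.lift K f).ker :=
      LieSubmodule.lieSpan_le.2 fun r hr => by simpa using hf r hr
    intro r hr
    simpa using h hr
  { (Submodule.liftQ _ (FreeLieAlgebra.lift K f : FreeLieAlgebra K (Pair n) →ₗ[K] H) hle) with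
    map_lie' := by
      intro a b
      obtain ⟨a, rfl⟩ := LieSubmodule.Quotient.surjective_mk' _ a
      obtain ⟨b, rfl⟩ := LieSubmodule.Quotient.surjective_mk' _ b
      exact LieHom.map_lie (FreeLieAlgebra.lift K f) a b }

@[simp]
theorem DK.lift_A {H : Type*} [LieRing H] [LieAlgebra K H] (f : Pair n → H)
    (hf : ∀ r, IsRelator K n r → FreeLieAlgebra.lift K f r = 0) (i j : Fin n) (h : i ≠ j) :
    DK.lift f hf (A K i j h) = f ⟨(i, j), h⟩ :=
  FreeLieAlgebra.lift_of_apply f _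

theorem DK.induction {p : DK K n → Prop} (of : ∀ i j h, p (A K i j h)) (zero : p 0)
    (add : ∀ a b, p a → p b → p (a + b)) (smul : ∀ (t : K) a, p a → p (t • a))
    (lie : ∀ a b, p a → p b → p ⁅a, b⁆) (a : DK K n) : p a := by
  obtain ⟨a, rfl⟩ := LieSubmodule.Quotient.surjective_mk' _ a
  induction a using free_induction with
  | of i => exact of i.1.1 i.1.2 i.2
  | zero => simpa using zero
  | add a b ha hb => rw [map_add]; exact add _ _ ha hb
  | smul t a ha => rw [map_smul]; exact smul _ _ ha
  | lie a b ha hb => exact lie _ _ ha hb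

theorem DK.rel {r : FreeLieAlgebra K (Pair n)} (hr : IsRelator K n r) :
    (LieSubmodule.Quotient.mk r : DK K n) = 0 :=
  (LieSubmodule.Quotient.mk_eq_zero' ..).2 (LieSubmodule.subset_lieSpan hr)

theorem A_symm (i j : Fin n) (h : i ≠ j) : A K i j h = A K j i h.symm :=
  sub_eq_zero.1 (DK.rel (IsRelator.symm i j h))

theorem A_three (i j k : Fin n) (hij : i ≠ j) (hik : i ≠ k) (hjk : j ≠ k) :
    ⁅A K i k hik, A K i j hij + A K j k hjk⁆ = 0 :=
  DK.rel (IsRelator.three i j k hij hik hjk)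

theorem A_four (i j k l : Fin n) (hij : i ≠ j) (hik : i ≠ k) (hil : i ≠ l) (hjk : j ≠ k)
    (hjl : j ≠ l) (hkl : k ≠ l) : ⁅A K i j hij, A K k l hkl⁆ = 0 :=
  DK.rel (IsRelator.four i j k l hij hik hil hjk hjl hkl)

variable (K) in
/-- The derivation by which `A_{i,j}` acts: `x_i ↦ [x_i, x_j]`, `x_j ↦ [x_j, x_i]`, and
`x_k ↦ 0` for the other generators. -/
def thetaGen (i j : Fin n) : LieDerivation K (L K n) (L K n) :=
  derivOf fun k => if i = k then ⁅x K i, x K j⁆ else if j = k then ⁅x K j, x K i⁆ else 0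

theorem thetaGen_x (i j k : Fin n) :
    thetaGen K i j (x K k)
      = if i = k then ⁅x K i, x K j⁆ else if j = k then ⁅x K j, x K i⁆ else 0 :=
  derivOf_of _ k

variable (K n) in
/-- The infinitesimal braid action `θ : 𝔓_n → Der(𝕃_n)`. -/
def theta : DK K n →ₗ⁅K⁆ LieDerivation K (L K n) (L K n) :=
  DK.lift (fun p => thetaGen K p.1.1 p.1.2) (by
    intro r hr
    cases hr with
    | symm i j h =>
      simp only [map_sub, FreeLieAlgebra.lift_of_apply]
      rw [sub_eq_zero]
      apply deriv_ext
      intro m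
      change thetaGen K i j (x K m) = thetaGen K j i (x K m)
      rw [thetaGen_x, thetaGen_x]
      split_ifs <;> simp_all
    | three i j k hij hik hjk =>
      simp only [map_add, LieHom.map_lie, FreeLieAlgebra.lift_of_apply]
      apply deriv_ext
      intro m
      change ⁅thetaGen K i k, thetaGen K i j + thetaGen K j k⁆ (x K m) = 0
      rw [LieDerivation.commutator_apply]
      by_cases him : i = m
      · subst him
        simp [thetaGen_x, hij, hij.symm, hik, hik.symm, hjk, hjk.symm]
      by_cases hjm : j = m
      · subst hjm
        simp [thetaGen_x, hij, hik, hjk.symm]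
        rw [← lie_add, ← lie_skew (x K i) (x K k), neg_add_cancel, lie_zero]
      by_cases hkm : k = m
      · subst hkm
        simp [thetaGen_x, hij, hij.symm, hik, hik.symm, hjk, hjk.symm]
      simp [thetaGen_x, him, hjm, hkm]
    | four i j k l hij hik hil hjk hjl hkl =>
      simp only [LieHom.map_lie, FreeLieAlgebra.lift_of_apply]
      apply deriv_ext
      intro m
      change ⁅thetaGen K i j, thetaGen K k l⁆ (x K m) = 0
      rw [LieDerivation.commutator_apply]
      by_cases him : i = m
      · subst him
        simp [thetaGen_x, hik.symm, hil.symm, hjk.symm, hjl.symm]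
      by_cases hjm : j = m
      · subst hjm
        simp [thetaGen_x, hij, hik.symm, hil.symm, hjk.symm, hjl.symm]
      by_cases hkm : k = m
      · subst hkm
        simp [thetaGen_x, hik, hil, hjk, hjl]
      by_cases hlm : l = m
      · subst hlm
        simp [thetaGen_x, hik, hil, hjk, hjl, hkl]
      simp [thetaGen_x, him, hjm, hkm, hlm])

@[simp]
theorem theta_A (i j : Fin n) (h : i ≠ j) : theta K n (A K i j h) = thetaGen K i j :=
  DK.lift_A _ _ i j h

end DrinfeldKohno

/-! ### The semidirect sum and its action on `𝕃_{n+1}` -/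

section Semidirect

variable {K : Type*} [Field K] {n : ℕ} {𝔤 : Type*} [LieRing 𝔤] [LieAlgebra K 𝔤]

/-- `θ_g = θ ∘ g : 𝔤 → Der(𝕃_n)`. -/
def thetaOf (g : 𝔤 →ₗ⁅K⁆ DK K n) : 𝔤 →ₗ⁅K⁆ LieDerivation K (L K n) (L K n) :=
  (theta K n).comp g

/-- The semidirect sum `𝕃_n ⊕_{θ_g} 𝔤`. -/
abbrev Sd (g : 𝔤 →ₗ⁅K⁆ DK K n) : Type _ := LieAlgebra.SemiDirectSum (L K n) 𝔤 (thetaOf g)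

/-- The inclusion `𝕃_n → 𝕃_n ⊕_{θ_g} 𝔤`. -/
abbrev inL (g : 𝔤 →ₗ⁅K⁆ DK K n) : L K n →ₗ⁅K⁆ Sd g := LieAlgebra.SemiDirectSum.inl (thetaOf g)

/-- The inclusion `𝔤 → 𝕃_n ⊕_{θ_g} 𝔤`. -/
abbrev inG (g : 𝔤 →ₗ⁅K⁆ DK K n) : 𝔤 →ₗ⁅K⁆ Sd g := LieAlgebra.SemiDirectSum.inr (thetaOf g)

variable (K n) in
/-- The inclusion `𝔓_n → 𝔓_{n+1}`, `A_{i,j} ↦ A_{i,j}`. -/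
def dkIncl : DK K n →ₗ⁅K⁆ DK K (n + 1) :=
  DK.lift (fun p => A K p.1.1.castSucc p.1.2.castSucc
      (fun h => p.2 (Fin.castSucc_injective n h))) (by
    intro r hr
    cases hr with
    | symm i j h =>
      simp only [map_sub, FreeLieAlgebra.lift_of_apply]
      exact sub_eq_zero.2 (A_symm ..)
    | three i j k hij hik hjk =>
      simp only [map_add, LieHom.map_lie, FreeLieAlgebra.lift_of_apply]
      exact A_three ..
    | four i j k l hij hik hil hjk hjl hkl =>
      simp only [LieHom.map_lie, FreeLieAlgebra.lift_of_apply]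
      apply A_four <;> (intro h'; have := Fin.castSucc_injective n h'; contradiction))

variable (K n) in
/-- The inclusion `𝕃_n → 𝔓_{n+1}`, `x_i ↦ A_{i,n+1}`. -/
def freeToDK : L K n →ₗ⁅K⁆ DK K (n + 1) :=
  FreeLieAlgebra.lift K fun i => A K i.castSucc (Fin.last n) (Fin.castSucc_ne_last i)

theorem dkIncl_lie_freeToDK (p : DK K n) (a : L K n) :
    ⁅dkIncl K n p, freeToDK K n a⁆ = freeToDK K n (theta K n p a) := by
  induction p using DK.induction generalizing a with
  | zero => simp
  | add p q hp hq => simp [hp, hq]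
  | smul t p hp => simp [hp]
  | lie p q hp hq =>
    rw [LieHom.map_lie, LieHom.map_lie, LieDerivation.commutator_apply, map_sub, ← hp, ← hq,
      ← hq, ← hp, lie_lie]
  | of i j h =>
    induction a using free_induction with
    | zero => simp
    | add a b ha hb => simp [ha, hb]
    | smul t a ha => simp [ha]
    | lie a b ha hb =>
      rw [LieHom.map_lie, leibniz_lie, ha, hb, LieDerivation.apply_lie_eq_add, map_add,
        LieHom.map_lie, LieHom.map_lie]
      exact add_comm _ _
    | of k =>
      have hi := Fin.castSucc_ne_last i
      have hj := Fin.castSucc_ne_last j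
      have hk := Fin.castSucc_ne_last k
      have hij : i.castSucc ≠ j.castSucc := fun h' => h (Fin.castSucc_injective n h')
      have key : ∀ (a b : Fin (n + 1)) (hab : a ≠ b) (ha : a ≠ Fin.last n)
          (hb : b ≠ Fin.last n),
          ⁅A K a b hab, A K a _ ha⁆ = ⁅A K a _ ha, A K b _ hb⁆ := by
        intro a b hab ha hb
        have h3 := A_three (K := K) a b (Fin.last n) hab ha hb
        rw [lie_add, add_eq_zero_iff_eq_neg'] at h3
        rw [h3, lie_skew]
      rw [theta_A]
      change ⁅dkIncl K n (A K i j h), freeToDK K n (x K k)⁆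
        = freeToDK K n (thetaGen K i j (x K k))
      rw [thetaGen_x]
      simp only [dkIncl, freeToDK, DK.lift_A, FreeLieAlgebra.lift_of_apply]
      by_cases hik : i = k
      · subst hik
        simp only [if_true, LieHom.map_lie, FreeLieAlgebra.lift_of_apply]
        exact key _ _ hij hi hj
      by_cases hjk : j = k
      · subst hjk
        simp only [hik, if_false, if_true, LieHom.map_lie, FreeLieAlgebra.lift_of_apply]
        rw [A_symm]
        exact key _ _ hij.symm hj hi
      simp only [hik, hjk, if_false, map_zero]
      exact A_four _ _ _ _ hij (fun h' => hik (Fin.castSucc_injective n h')) hi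
        (fun h' => hjk (Fin.castSucc_injective n h')) hj hk

/-- The homomorphism `id ⊕ g : 𝕃_n ⊕_{θ_g} 𝔤 → 𝕃_n ⊕_θ 𝔓_n = 𝔓_{n+1}`. -/
def idPlus (g : 𝔤 →ₗ⁅K⁆ DK K n) : Sd g →ₗ⁅K⁆ DK K (n + 1) where
  toFun s := freeToDK K n s.left + dkIncl K n (g s.right)
  map_add' s t := by simp; abel
  map_smul' c s := by simp
  map_lie' := by
    intro s t
    have h1 := dkIncl_lie_freeToDK (g s.right) t.left
    have h2 := dkIncl_lie_freeToDK (g t.right) s.left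
    simp only [LieAlgebra.SemiDirectSum.lie_eq_mk, map_add, map_sub, LieHom.map_lie, thetaOf,
      LieHom.comp_apply, lie_add, add_lie, ← h1, ← h2]
    rw [← lie_skew (dkIncl K n (g t.right)) (freeToDK K n s.left)]
    abel

/-- The action `θ_{id ⊕ g} : 𝕃_n ⊕_{θ_g} 𝔤 → Der(𝕃_{n+1})`. -/
def thetaId (g : 𝔤 →ₗ⁅K⁆ DK K n) :
    Sd g →ₗ⁅K⁆ LieDerivation K (L K (n + 1)) (L K (n + 1)) :=
  (theta K (n + 1)).comp (idPlus g)

theorem theta_x (p : DK K n) (i : Fin n) : ∃ w, theta K n p (x K i) = ⁅x K i, w⁆ := by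
  induction p using DK.induction with
  | zero => exact ⟨0, by simp⟩
  | add p q hp hq =>
    obtain ⟨u, hu⟩ := hp
    obtain ⟨v, hv⟩ := hq
    exact ⟨u + v, by simp [hu, hv]⟩
  | smul t p hp =>
    obtain ⟨u, hu⟩ := hp
    exact ⟨t • u, by simp [hu]⟩
  | lie p q hp hq =>
    obtain ⟨u, hu⟩ := hp
    obtain ⟨v, hv⟩ := hq
    refine ⟨⁅u, v⁆ + theta K n p v - theta K n q u, ?_⟩
    rw [LieHom.map_lie, LieDerivation.commutator_apply, hu, hv,
      LieDerivation.apply_lie_eq_add, LieDerivation.apply_lie_eq_add, hu, hv, lie_sub, lie_add,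
      leibniz_lie (x K i) u v, ← lie_skew ⁅x K i, v⁆ u]
    abel
  | of j k h =>
    rw [theta_A, thetaGen_x]
    split_ifs with h1 h2
    · subst h1; exact ⟨_, rfl⟩
    · subst h2; exact ⟨_, rfl⟩
    · exact ⟨0, by simp⟩

theorem theta_sum (p : DK K n) : theta K n p (∑ i, x K i) = 0 := by
  induction p using DK.induction with
  | zero => simp
  | add p q hp hq => rw [map_add, LieDerivation.add_apply, hp, hq, add_zero]
  | smul t p hp => rw [map_smul, LieDerivation.smul_apply, hp, smul_zero]
  | lie p q hp hq =>
    rw [LieHom.map_lie, LieDerivation.commutator_apply, hp, hq, map_zero, map_zero, sub_zero]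
  | of j k h =>
    rw [theta_A, map_sum, ← Finset.add_sum_erase _ _ (Finset.mem_univ j),
      ← Finset.add_sum_erase _ _ (Finset.mem_erase.2 ⟨h.symm, Finset.mem_univ k⟩),
      Finset.sum_eq_zero, thetaGen_x, thetaGen_x]
    · simp only [h, if_true, if_false, add_zero]
      rw [← lie_skew, neg_add_cancel]
    · intro m hm
      simp only [Finset.mem_erase] at hm
      rw [thetaGen_x, if_neg (Ne.symm hm.2.1), if_neg (Ne.symm hm.1)]

variable (K n) in
/-- The inclusion `𝕃_n → 𝕃_{n+1}`. -/
def freeIncl : L K n →ₗ⁅K⁆ L K (n + 1) := FreeLieAlgebra.lift K fun i => x K i.castSucc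

theorem theta_dkIncl_last (p : DK K n) :
    theta K (n + 1) (dkIncl K n p) (x K (Fin.last n)) = 0 := by
  induction p using DK.induction with
  | zero => simp
  | add p q hp hq => rw [map_add, map_add, LieDerivation.add_apply, hp, hq, add_zero]
  | smul t p hp => rw [map_smul, map_smul, LieDerivation.smul_apply, hp, smul_zero]
  | lie p q hp hq =>
    rw [LieHom.map_lie, LieHom.map_lie, LieDerivation.commutator_apply, hp, hq, map_zero,
      map_zero, sub_zero]
  | of i j h =>
    rw [dkIncl, DK.lift_A, theta_A, thetaGen_x, if_neg (Fin.castSucc_ne_last i),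
      if_neg (Fin.castSucc_ne_last j)]

theorem theta_dkIncl (p : DK K n) (a : L K n) :
    theta K (n + 1) (dkIncl K n p) (freeIncl K n a) = freeIncl K n (theta K n p a) := by
  induction p using DK.induction generalizing a with
  | zero => simp
  | add p q hp hq => simp [hp, hq]
  | smul t p hp => simp [hp]
  | lie p q hp hq =>
    rw [LieHom.map_lie, LieHom.map_lie, LieHom.map_lie, LieDerivation.commutator_apply,
      LieDerivation.commutator_apply, map_sub, hp, hq, hp, hq]
  | of i j h =>
    induction a using free_induction with
    | zero => simp
    | add a b ha hb => simp [ha, hb]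
    | smul t a ha => simp [ha]
    | lie a b ha hb =>
      rw [LieHom.map_lie, LieDerivation.apply_lie_eq_add, LieDerivation.apply_lie_eq_add, map_add,
        LieHom.map_lie, LieHom.map_lie, ha, hb]
    | of k =>
      rw [dkIncl, DK.lift_A, theta_A, theta_A]
      change thetaGen K i.castSucc j.castSucc (freeIncl K n (x K k))
        = freeIncl K n (thetaGen K i j (x K k))
      rw [freeIncl, FreeLieAlgebra.lift_of_apply, thetaGen_x, thetaGen_x]
      simp only [Fin.castSucc_inj]
      split_ifs <;> simp

end Semidirect

/-! ### Representations on subspaces, quotients and tensor products -/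

section Rep

variable {K : Type*} [Field K] {S : Type*} [LieRing S] [LieAlgebra K S]
variable {E F : Type*} [AddCommGroup E] [Module K E] [AddCommGroup F] [Module K F]

/-- The representation on an invariant subspace. -/
def subRep (r : S →ₗ⁅K⁆ Module.End K E) (N : Submodule K E) (h : ∀ s, ∀ e ∈ N, r s e ∈ N) :
    S →ₗ⁅K⁆ Module.End K N where
  toFun s := (r s).restrict (h s)
  map_add' s t := by ext; simp
  map_smul' c s := by ext; simp
  map_lie' := by intro s t; ext; simp [LieRing.of_associative_ring_bracket]

/-- The representation on the quotient by an invariant subspace. -/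
def quotRep (r : S →ₗ⁅K⁆ Module.End K E) (N : Submodule K E) (h : ∀ s, ∀ e ∈ N, r s e ∈ N) :
    S →ₗ⁅K⁆ Module.End K (E ⧸ N) where
  toFun s := N.mapQ N (r s) (h s)
  map_add' s t := by ext; simp
  map_smul' c s := by ext; simp
  map_lie' := by intro s t; ext; simp [LieRing.of_associative_ring_bracket]

/-- The tensor product of two representations, `s ⬝ (e ⊗ f) = (s ⬝ e) ⊗ f + e ⊗ (s ⬝ f)`. -/
def tensorRep (r : S →ₗ⁅K⁆ Module.End K E) (q : S →ₗ⁅K⁆ Module.End K F) :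
    S →ₗ⁅K⁆ Module.End K (E ⊗[K] F) where
  toFun s := (r s).rTensor F + (q s).lTensor E
  map_add' s t := by simp only [map_add, LinearMap.rTensor_add, LinearMap.lTensor_add]; abel
  map_smul' c s := by
    simp only [map_smul, LinearMap.rTensor_smul, LinearMap.lTensor_smul, smul_add,
      RingHom.id_apply]
  map_lie' := by
    intro s t
    apply TensorProduct.ext'
    intro e f
    simp only [LieHom.map_lie, LieRing.of_associative_ring_bracket, LinearMap.add_apply,
      LinearMap.rTensor_tmul, LinearMap.lTensor_tmul, LinearMap.sub_apply, Module.End.mul_apply,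
      map_add, TensorProduct.sub_tmul, TensorProduct.tmul_sub]
    abel

theorem tensorRep_tmul (r : S →ₗ⁅K⁆ Module.End K E) (q : S →ₗ⁅K⁆ Module.End K F) (s : S)
    (e : E) (f : F) : tensorRep r q s (e ⊗ₜ f) = r s e ⊗ₜ f + e ⊗ₜ q s f := rfl

end Rep

/-! ### Lie algebra homology in degree one -/

section Homology

variable {K : Type*} [Field K] {H H' : Type*} [LieRing H] [LieAlgebra K H] [LieRing H']
  [LieAlgebra K H'] {M : Type*} [AddCommGroup M] [Module K M]

/-- The image of the Chevalley–Eilenberg differential `Λ²H ⊗ M → H ⊗ M`,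
`x ∧ y ⊗ m ↦ [x, y] ⊗ m - x ⊗ y m + y ⊗ x m`. -/
def bdry (ρ : H →ₗ⁅K⁆ Module.End K M) : Submodule K (H ⊗[K] M) :=
  Submodule.span K {t | ∃ x y m, t = ⁅x, y⁆ ⊗ₜ m - x ⊗ₜ ρ y m + y ⊗ₜ ρ x m}

/-- The space `(H ⊗ M) / im (Λ²H ⊗ M)`. The map `x ⊗ m ↦ x ⊗ m` identifies it with
`𝓘_H ⊗_{U(H)} M`, where `𝓘_H` is the augmentation ideal of the universal enveloping algebra `U(H)`:
as a right `U(H)`-module, `𝓘_H` has generators `x ∈ H` (linear in `x`) and relations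
`[x, y] = x ⬝ y - y ⬝ x`. -/
abbrev Coker (ρ : H →ₗ⁅K⁆ Module.End K M) : Type _ := (H ⊗[K] M) ⧸ bdry ρ

/-- The class of `x ⊗ m`. -/
abbrev cls (ρ : H →ₗ⁅K⁆ Module.End K M) (x : H) (m : M) : Coker ρ := (bdry ρ).mkQ (x ⊗ₜ m)

theorem cls_lie (ρ : H →ₗ⁅K⁆ Module.End K M) (x y : H) (m : M) :
    cls ρ ⁅x, y⁆ m = cls ρ x (ρ y m) - cls ρ y (ρ x m) := by
  rw [← sub_eq_zero, cls, cls, cls, ← map_sub, ← map_sub]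
  apply (Submodule.Quotient.mk_eq_zero _).2
  apply Submodule.subset_span
  exact ⟨x, y, m, by abel⟩

/-- The Chevalley–Eilenberg differential `H ⊗ M → M`, `x ⊗ m ↦ x m`. -/
def d1 (ρ : H →ₗ⁅K⁆ Module.End K M) : H ⊗[K] M →ₗ[K] M :=
  TensorProduct.lift (ρ : H →ₗ[K] Module.End K M)

theorem bdry_le (ρ : H →ₗ⁅K⁆ Module.End K M) : bdry ρ ≤ LinearMap.ker (d1 ρ) := by
  apply Submodule.span_le.2
  rintro _ ⟨x, y, m, rfl⟩
  simp [d1, LieRing.of_associative_ring_bracket]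

/-- The map `(H ⊗ M) / im (Λ²H ⊗ M) → M` induced by the differential. -/
def d1bar (ρ : H →ₗ⁅K⁆ Module.End K M) : Coker ρ →ₗ[K] M := (bdry ρ).liftQ (d1 ρ) (bdry_le ρ)

@[simp]
theorem d1bar_cls (ρ : H →ₗ⁅K⁆ Module.End K M) (x : H) (m : M) :
    d1bar ρ (cls ρ x m) = ρ x m := rfl

/-- The first Lie algebra homology `H_1(H, M) = ker (H ⊗ M → M) / im (Λ²H ⊗ M → H ⊗ M)`. -/
def H1 (ρ : H →ₗ⁅K⁆ Module.End K M) : Submodule K (Coker ρ) := LinearMap.ker (d1bar ρ)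

/-- The map on `(H ⊗ M) / im (Λ²H ⊗ M)` induced by a homomorphism of Lie algebras. -/
def cokerMap (f : H' →ₗ⁅K⁆ H) (ρ : H →ₗ⁅K⁆ Module.End K M) : Coker (ρ.comp f) →ₗ[K] Coker ρ :=
  (bdry (ρ.comp f)).mapQ (bdry ρ) ((f : H' →ₗ[K] H).rTensor M) (by
    apply Submodule.span_le.2
    rintro _ ⟨x, y, m, rfl⟩
    apply Submodule.subset_span
    exact ⟨f x, f y, m, by simp⟩)

@[simp]
theorem cokerMap_cls (f : H' →ₗ⁅K⁆ H) (ρ : H →ₗ⁅K⁆ Module.End K M) (x : H') (m : M) :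
    cokerMap f ρ (cls (ρ.comp f) x m) = cls ρ (f x) m := rfl

theorem coker_induction {ρ : H →ₗ⁅K⁆ Module.End K M} {p : Coker ρ → Prop}
    (cls : ∀ x m, p (cls ρ x m)) (add : ∀ a b, p a → p b → p (a + b)) (c : Coker ρ) : p c := by
  obtain ⟨t, rfl⟩ := (bdry ρ).mkQ_surjective c
  induction t using TensorProduct.induction_on with
  | zero => simpa using cls 0 0
  | tmul x m => exact cls x m
  | add a b ha hb => rw [map_add]; exact add _ _ ha hb

theorem d1bar_cokerMap (f : H' →ₗ⁅K⁆ H) (ρ : H →ₗ⁅K⁆ Module.End K M) (c : Coker (ρ.comp f)) :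
    d1bar ρ (cokerMap f ρ c) = d1bar (ρ.comp f) c := by
  induction c using coker_induction with
  | cls x m => rw [cokerMap_cls, d1bar_cls, d1bar_cls]; rfl
  | add a b ha hb => rw [map_add, map_add, map_add, ha, hb]

/-- The map `H_1(H', M) → H_1(H, M)` induced by a homomorphism of Lie algebras `H' → H`. -/
def H1map (f : H' →ₗ⁅K⁆ H) (ρ : H →ₗ⁅K⁆ Module.End K M) : H1 (ρ.comp f) →ₗ[K] H1 ρ :=
  (cokerMap f ρ).restrict fun c hc => by
    have hc' : d1bar (ρ.comp f) c = 0 := hc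
    change d1bar ρ (cokerMap f ρ c) = 0
    rw [d1bar_cokerMap, hc']

theorem H1map_coe (f : H' →ₗ⁅K⁆ H) (ρ : H →ₗ⁅K⁆ Module.End K M) (c : H1 (ρ.comp f)) :
    (H1map f ρ c : Coker ρ) = cokerMap f ρ c := rfl

/-- The homomorphism `𝕃(x) → H` from the free Lie algebra on one generator, with `x ↦ y`. -/
def oneGen (y : H) : FreeLieAlgebra K Unit →ₗ⁅K⁆ H := FreeLieAlgebra.lift K fun _ => y

theorem mem_range_H1map (ρ : H →ₗ⁅K⁆ Module.End K M) (y : H) (c : H1 ρ) :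
    c ∈ LinearMap.range (H1map (oneGen y) ρ) ↔ ∃ m, ρ y m = 0 ∧ (c : Coker ρ) = cls ρ y m := by
  have hy : oneGen (K := K) y (FreeLieAlgebra.of K ()) = y := FreeLieAlgebra.lift_of_apply _ _
  have hone : ∀ a : FreeLieAlgebra K Unit, ∃ t : K, a = t • FreeLieAlgebra.of K () := by
    intro a
    induction a using free_induction with
    | of i => exact ⟨1, by simp⟩
    | zero => exact ⟨0, by simp⟩
    | add a b ha hb =>
      obtain ⟨s, rfl⟩ := ha
      obtain ⟨t, rfl⟩ := hb
      exact ⟨s + t, by rw [add_smul]⟩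
    | smul t a ha =>
      obtain ⟨s, rfl⟩ := ha
      exact ⟨t * s, by rw [mul_smul]⟩
    | lie a b ha hb =>
      obtain ⟨s, rfl⟩ := ha
      obtain ⟨t, rfl⟩ := hb
      exact ⟨0, by simp⟩
  constructor
  · rintro ⟨⟨b, hb⟩, rfl⟩
    have hb' : d1bar (ρ.comp (oneGen y)) b = 0 := hb
    have : ∃ m, b = cls (ρ.comp (oneGen y)) (FreeLieAlgebra.of K ()) m := by
      clear hb hb'
      induction b using coker_induction with
      | cls a m =>
        obtain ⟨t, rfl⟩ := hone a
        exact ⟨t • m, by rw [cls, cls, TensorProduct.smul_tmul]⟩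
      | add a b ha hb =>
        obtain ⟨u, rfl⟩ := ha
        obtain ⟨v, rfl⟩ := hb
        exact ⟨u + v, by rw [cls, cls, cls, TensorProduct.tmul_add, map_add]⟩
    obtain ⟨m, rfl⟩ := this
    refine ⟨m, ?_, ?_⟩
    · rw [d1bar_cls, LieHom.comp_apply, hy] at hb'
      exact hb'
    · rw [H1map_coe, cokerMap_cls, hy]
  · rintro ⟨m, hm, hc⟩
    have hmem : cls (ρ.comp (oneGen y)) (FreeLieAlgebra.of K ()) m ∈ H1 (ρ.comp (oneGen y)) := by
      change d1bar _ _ = 0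
      rw [d1bar_cls, LieHom.comp_apply, hy, hm]
    refine ⟨⟨_, hmem⟩, Subtype.ext ?_⟩
    rw [H1map_coe, cokerMap_cls, hy, hc]

variable {S : Type*} [LieRing S] [LieAlgebra K S]

/-- A Lie algebra `S` acting on `H` by derivations and on `M` compatibly acts on
`(H ⊗ M) / im (Λ²H ⊗ M)` by `s ⬝ (x ⊗ m) = (s ⬝ x) ⊗ m + x ⊗ (s ⬝ m)`. -/
def cokerRep (ρ : H →ₗ⁅K⁆ Module.End K M) (D : S →ₗ⁅K⁆ LieDerivation K H H)
    (T : S →ₗ⁅K⁆ Module.End K M) (hT : ∀ s x, ⁅T s, ρ x⁆ = ρ (D s x)) :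
    S →ₗ⁅K⁆ Module.End K (Coker ρ) :=
  quotRep (tensorRep ((LieDerivation.toLinearMapLieHom K H).comp D) T) (bdry ρ) (by
    intro s e he
    have hT' : ∀ x m, T s (ρ x m) = ρ x (T s m) + ρ (D s x) m := by
      intro x m
      rw [← hT, LieRing.of_associative_ring_bracket, LinearMap.sub_apply, Module.End.mul_apply,
        Module.End.mul_apply]
      abel
    induction he using Submodule.span_induction with
    | mem t ht =>
      obtain ⟨x, y, m, rfl⟩ := ht
      have key : tensorRep ((LieDerivation.toLinearMapLieHom K H).comp D) T s
          (⁅x, y⁆ ⊗ₜ m - x ⊗ₜ ρ y m + y ⊗ₜ ρ x m)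
          = (⁅D s x, y⁆ ⊗ₜ m - D s x ⊗ₜ ρ y m + y ⊗ₜ ρ (D s x) m)
            + (⁅x, D s y⁆ ⊗ₜ m - x ⊗ₜ ρ (D s y) m + D s y ⊗ₜ ρ x m)
            + (⁅x, y⁆ ⊗ₜ T s m - x ⊗ₜ ρ y (T s m) + y ⊗ₜ ρ x (T s m)) := by
        rw [map_add, map_sub, tensorRep_tmul, tensorRep_tmul, tensorRep_tmul]
        change D s ⁅x, y⁆ ⊗ₜ[K] m + _ - (D s x ⊗ₜ[K] _ + _) + (D s y ⊗ₜ[K] _ + _) = _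
        rw [LieDerivation.apply_lie_eq_add, hT', hT', TensorProduct.add_tmul,
          TensorProduct.tmul_add, TensorProduct.tmul_add]
        abel
      rw [key]
      refine add_mem (add_mem ?_ ?_) ?_ <;> exact Submodule.subset_span ⟨_, _, _, rfl⟩
    | zero => rw [map_zero]; exact zero_mem _
    | add a b _ _ ha hb => rw [map_add]; exact add_mem ha hb
    | smul c a _ ha => rw [map_smul]; exact Submodule.smul_mem _ _ ha)

theorem cokerRep_cls (ρ : H →ₗ⁅K⁆ Module.End K M) (D : S →ₗ⁅K⁆ LieDerivation K H H)
    (T : S →ₗ⁅K⁆ Module.End K M) (hT : ∀ s x, ⁅T s, ρ x⁆ = ρ (D s x)) (s : S) (x : H) (m : M) :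
    cokerRep ρ D T hT s (cls ρ x m) = cls ρ (D s x) m + cls ρ x (T s m) := rfl

/-- The induced action on `H_1(H, M)`. -/
def H1rep (ρ : H →ₗ⁅K⁆ Module.End K M) (D : S →ₗ⁅K⁆ LieDerivation K H H)
    (T : S →ₗ⁅K⁆ Module.End K M) (hT : ∀ s x, ⁅T s, ρ x⁆ = ρ (D s x)) :
    S →ₗ⁅K⁆ Module.End K (H1 ρ) :=
  subRep (cokerRep ρ D T hT) (H1 ρ) (by
    intro s c hc
    have hc' : d1bar ρ c = 0 := hc
    have key : ∀ c, d1bar ρ (cokerRep ρ D T hT s c) = T s (d1bar ρ c) := by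
      intro c
      induction c using coker_induction with
      | cls x m =>
        rw [cokerRep_cls, map_add, d1bar_cls, d1bar_cls, d1bar_cls, ← hT,
          LieRing.of_associative_ring_bracket, LinearMap.sub_apply, Module.End.mul_apply,
          Module.End.mul_apply, sub_add_cancel]
      | add a b ha hb => rw [map_add, map_add, map_add, map_add, ha, hb]
    change d1bar ρ _ = 0
    rw [key, hc', map_zero])

theorem range_H1map_stable (ρ : H →ₗ⁅K⁆ Module.End K M) (D : S →ₗ⁅K⁆ LieDerivation K H H)
    (T : S →ₗ⁅K⁆ Module.End K M) (hT : ∀ s x, ⁅T s, ρ x⁆ = ρ (D s x)) (y : H)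
    (hy : ∀ s, ∃ w, D s y = ⁅y, w⁆) (s : S) (c : H1 ρ)
    (hc : c ∈ LinearMap.range (H1map (oneGen y) ρ)) :
    H1rep ρ D T hT s c ∈ LinearMap.range (H1map (oneGen y) ρ) := by
  rw [mem_range_H1map] at hc ⊢
  obtain ⟨m, hm, hc⟩ := hc
  obtain ⟨w, hw⟩ := hy s
  refine ⟨ρ w m + T s m, ?_, ?_⟩
  · have h1 : ρ (D s y) m = T s (ρ y m) - ρ y (T s m) := by rw [← hT]; rfl
    have h2 : ρ ⁅y, w⁆ m = ρ y (ρ w m) - ρ w (ρ y m) := by rw [LieHom.map_lie]; rfl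
    rw [hw, h2, hm, map_zero, map_zero, sub_zero, zero_sub] at h1
    rw [map_add, h1, neg_add_cancel]
  · change cokerRep ρ D T hT s (c : Coker ρ) = _
    rw [hc, cokerRep_cls, hw, cls_lie, hm, cls, cls, cls, cls, TensorProduct.tmul_zero, map_zero,
      sub_zero, TensorProduct.tmul_add, map_add]

end Homology

/-! ### Modules -/

section Modules

universe u v w

variable (K : Type u) [Field K] (S : Type v) [LieRing S] [LieAlgebra K S]

/-- A module over a Lie algebra `S`, that is, over its universal enveloping algebra `U(S)`. -/
structure LieMod where
  /-- The underlying vector space. -/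
  carrier : Type w
  [addCommGroup : AddCommGroup carrier]
  [module : Module K carrier]
  [lieRingModule : LieRingModule S carrier]
  [lieModule : LieModule K S carrier]

attribute [instance] LieMod.addCommGroup LieMod.module LieMod.lieRingModule LieMod.lieModule

variable {K S}

/-- The module given by a representation. -/
def LieMod.ofRep {E : Type w} [AddCommGroup E] [Module K E] (r : S →ₗ⁅K⁆ Module.End K E) :
    LieMod.{u, v, w} K S :=
  letI := LieRingModule.compLieHom E r
  haveI := LieModule.compLieHom E r
  { carrier := E }

/-- Restriction along a homomorphism of Lie algebras. -/
def LieMod.res {S' : Type*} [LieRing S'] [LieAlgebra K S'] (f : S' →ₗ⁅K⁆ S)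
    (V : LieMod.{u, v, w} K S) : LieMod K S' :=
  letI := LieRingModule.compLieHom V.carrier f
  haveI := LieModule.compLieHom V.carrier f
  { carrier := V.carrier }

/-- Irreducibility: the module is nonzero and has no submodules besides `0` and itself. -/
def LieMod.IsIrreducible (V : LieMod.{u, v, w} K S) : Prop :=
  LieModule.IsIrreducible K S V.carrier

end Modules

/-! ### The middle convolution for `λ ≠ 0` -/

section NonZero

universe u v w

variable {K : Type u} [Field K] {n : ℕ} {𝔤 : Type v} [LieRing 𝔤] [LieAlgebra K 𝔤]
  (g : 𝔤 →ₗ⁅K⁆ DK K n) (V : Type w) [AddCommGroup V] [Module K V] [LieRingModule (Sd g) V]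
  [LieModule K (Sd g) V] (lam : K)

/-- The action of `𝕃_n` on `V`. -/
def actL : L K n →ₗ⁅K⁆ Module.End K V := (LieModule.toEnd K (Sd g) V).comp (inL g)

/-- The action of `𝔤` on `V`. -/
def actG : 𝔤 →ₗ⁅K⁆ Module.End K V := (LieModule.toEnd K (Sd g) V).comp (inG g)

theorem actG_actL (X : 𝔤) (a : L K n) (v : V) :
    actG g V X (actL g V a v) = actL g V (thetaOf g X a) v + actL g V a (actG g V X v) := by
  have h2 : inL g (thetaOf g X a) = ⁅inG g X, inL g a⁆ := by simp
  change ⁅inG g X, ⁅inL g a, v⁆⁆ = ⁅inL g (thetaOf g X a), v⁆ + ⁅inL g a, ⁅inG g X, v⁆⁆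
  rw [h2]
  exact leibniz_lie (inG g X) (inL g a) v

theorem actL_lie (a b : L K n) (v : V) :
    actL g V ⁅a, b⁆ v = actL g V a (actL g V b v) - actL g V b (actL g V a v) := by
  rw [LieHom.map_lie]; rfl

theorem actG_lie (X Y : 𝔤) (v : V) :
    actG g V ⁅X, Y⁆ v = actG g V X (actG g V Y v) - actG g V Y (actG g V X v) := by
  rw [LieHom.map_lie]; rfl

variable (K n) in
/-- The projection `𝕃_{n+1} → 𝕃_n` killing `x_{n+1}`. -/
def pr : L K (n + 1) →ₗ⁅K⁆ L K n :=
  FreeLieAlgebra.lift K (Fin.lastCases 0 fun i => x K i)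

variable (K n) in
/-- The projection `𝕃_{n+1} → 𝕃(x_{n+1})` killing `x_1, …, x_n`. -/
def prLast : L K (n + 1) →ₗ⁅K⁆ FreeLieAlgebra K Unit :=
  FreeLieAlgebra.lift K (Fin.lastCases (FreeLieAlgebra.of K ()) fun _ => 0)

/-- The one-dimensional representation `K_λ` of `𝕃(x_{n+1})`. -/
def charRep : FreeLieAlgebra K Unit →ₗ⁅K⁆ Module.End K K :=
  FreeLieAlgebra.lift K fun _ => lam • 1

/-- `V ⊗ K_λ` as a representation of `𝕃_{n+1}`. -/
def twist : L K (n + 1) →ₗ⁅K⁆ Module.End K (V ⊗[K] K) :=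
  tensorRep ((actL g V).comp (pr K n))
    ((charRep lam).comp (prLast K n))

/-- The action of `(a, X) ∈ 𝕃_n ⊕ 𝔤` on `V ⊗ K_λ` through `X` acting on `V`. -/
def gAct : Sd g →ₗ⁅K⁆ Module.End K (V ⊗[K] K) :=
  tensorRep ((actG g V).comp (LieAlgebra.SemiDirectSum.projr (thetaOf g))) 0

theorem twist_last : twist g V lam (x K (Fin.last n)) = lam • 1 := by
  apply TensorProduct.ext'
  intro v t
  have h1 : pr K n (x K (Fin.last n)) = 0 := by
    rw [pr, FreeLieAlgebra.lift_of_apply, Fin.lastCases_last]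
  have h2 : charRep lam (prLast K n (x K (Fin.last n))) = lam • 1 := by
    rw [prLast, FreeLieAlgebra.lift_of_apply, Fin.lastCases_last, charRep,
      FreeLieAlgebra.lift_of_apply]
  rw [twist, tensorRep_tmul, LieHom.comp_apply, LieHom.comp_apply, h1, h2,
    map_zero, LinearMap.zero_apply, TensorProduct.zero_tmul, zero_add]
  exact TensorProduct.tmul_smul lam v t

theorem twist_incl (a : L K n) :
    twist g V lam (freeIncl K n a) = (actL g V a).rTensor K := by
  have h1 : (pr K n).comp (freeIncl K n) = LieHom.id := by
    ext i
    simp [pr, freeIncl]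
  have h2 : (prLast K n).comp (freeIncl K n) = 0 := by
    ext i
    simp [prLast, freeIncl]
  have h1' : pr K n (freeIncl K n a) = a := congrArg (fun f => f a) h1
  have h2' : prLast K n (freeIncl K n a) = 0 := congrArg (fun f => f a) h2
  apply TensorProduct.ext'
  intro v t
  rw [twist, tensorRep_tmul]
  simp only [LieHom.comp_apply, h1', h2', map_zero]
  simp

theorem twist_theta_freeToDK (a : L K n) (l : L K (n + 1)) :
    twist g V lam (theta K (n + 1) (freeToDK K n a) l) = 0 := by
  induction a using free_induction generalizing l with
  | zero => simp
  | add a b ha hb => simp [ha, hb]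
  | smul t a ha => simp [ha]
  | lie a b ha hb =>
    rw [LieHom.map_lie, LieHom.map_lie, LieDerivation.commutator_apply, map_sub, ha, hb, sub_zero]
  | of i =>
    induction l using free_induction with
    | zero => simp
    | add a b ha hb => rw [map_add, map_add, ha, hb, add_zero]
    | smul t a ha => rw [map_smul, map_smul, ha, smul_zero]
    | lie a b ha hb =>
      rw [LieDerivation.apply_lie_eq_add, map_add, LieHom.map_lie, LieHom.map_lie, ha, hb,
        lie_zero, zero_lie, add_zero]
    | of k =>
      have key : ⁅twist g V lam (x K i.castSucc), twist g V lam (x K (Fin.last n))⁆ = 0 := by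
        rw [twist_last, LieRing.of_associative_ring_bracket]
        simp
      rw [freeToDK, FreeLieAlgebra.lift_of_apply, theta_A, thetaGen_x]
      split_ifs with h1 h2
      · rw [LieHom.map_lie, key]
      · rw [LieHom.map_lie, ← lie_skew, key, neg_zero]
      · rw [map_zero]

theorem gAct_twist (s : Sd g) (l : L K (n + 1)) :
    ⁅gAct g V s, twist g V lam l⁆ = twist g V lam (thetaId g s l) := by
  obtain ⟨a, X⟩ := s
  have h0 : thetaId g ⟨a, X⟩ l = theta K (n + 1) (freeToDK K n a) l
      + theta K (n + 1) (dkIncl K n (g X)) l := by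
    change theta K (n + 1) (freeToDK K n a + dkIncl K n (g X)) l = _
    rw [map_add, LieDerivation.add_apply]
  rw [h0, map_add, twist_theta_freeToDK, zero_add]
  have hg : gAct g V ⟨a, X⟩ = (actG g V X).rTensor K := by
    apply TensorProduct.ext'
    intro v t
    rw [gAct, tensorRep_tmul]
    simp
  rw [hg]
  clear h0 hg
  induction l using free_induction with
  | zero => simp only [map_zero, lie_zero]
  | add a b ha hb => rw [map_add, lie_add, ha, hb, map_add, map_add]
  | smul t a ha =>
    rw [map_smul, map_smul, map_smul, ← ha, LieRing.of_associative_ring_bracket,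
      LieRing.of_associative_ring_bracket, mul_smul_comm, smul_mul_assoc, smul_sub]
  | lie a b ha hb =>
    rw [LieHom.map_lie, leibniz_lie, ha, hb, LieDerivation.apply_lie_eq_add, map_add,
      LieHom.map_lie, LieHom.map_lie]
    exact add_comm _ _
  | of k =>
    induction k using Fin.lastCases with
    | last =>
      have h1 := twist_last g V lam
      have h2 := theta_dkIncl_last (g X)
      rw [x] at h1 h2
      rw [h1, h2, map_zero, LieRing.of_associative_ring_bracket]
      simp
    | cast i =>
      have h1 : FreeLieAlgebra.of K i.castSucc = freeIncl K n (x K i) := by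
        rw [freeIncl, FreeLieAlgebra.lift_of_apply]
      rw [h1, theta_dkIncl, twist_incl, twist_incl]
      apply TensorProduct.ext'
      intro v t
      simp only [LieRing.of_associative_ring_bracket, LinearMap.sub_apply, Module.End.mul_apply,
        LinearMap.rTensor_tmul, actG_actL, TensorProduct.add_tmul, add_sub_cancel_right]
      rfl

/-- The elements `x_0 = -(x_1 + ⋯ + x_{n+1}), x_1, …, x_n` of `𝕃_{n+1}`. -/
def pt : Fin (n + 1) → L K (n + 1) :=
  Fin.cases (-∑ k, x K k) fun i => x K i.castSucc

theorem thetaId_pt (i : Fin (n + 1)) (s : Sd g) : 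
    ∃ w, thetaId g s (pt i) = ⁅(pt i : L K (n + 1)), w⁆ := by
  cases i using Fin.cases with
  | zero =>
    refine ⟨0, ?_⟩
    change theta K (n + 1) (idPlus g s) (-∑ k, x K k) = _
    rw [map_neg, theta_sum, lie_zero, neg_zero]
  | succ i => exact theta_x (idPlus g s) i.castSucc

/-- The action of `𝕃_n ⊕_{θ_g} 𝔤` on `H_1(𝕃_{n+1}, V ⊗ K_λ) ⊆ 𝓘 ⊗_U (V ⊗ K_λ)`:
`(a, X) ⬝ (i ⊗ v) = θ_{id ⊕ g}(a, X)(i) ⊗ v + i ⊗ (X ⬝ v)`. This is the deformed Long–Moody functor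
when `λ ≠ 0`. -/
def lmRep : Sd g →ₗ⁅K⁆ Module.End K (H1 (twist g V lam)) :=
  H1rep (twist g V lam) (thetaId g) (gAct g V) (gAct_twist g V lam)

/-- The image of `⨁_{i=0}^n H_1(𝕃(x_i), V ⊗ K_λ) → H_1(𝕃_{n+1}, V ⊗ K_λ)`. -/
def mcSub : Submodule K (H1 (twist g V lam)) :=
  ⨆ i : Fin (n + 1), LinearMap.range (H1map (oneGen (pt i)) (twist g V lam))

theorem mcSub_stable (s : Sd g) (c : H1 (twist g V lam)) (hc : c ∈ mcSub g V lam) :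
    lmRep g V lam s c ∈ mcSub g V lam := by
  induction hc using Submodule.iSup_induction' with
  | mem i c hc =>
    exact Submodule.mem_iSup_of_mem i
      (range_H1map_stable _ _ _ _ _ (fun s => thetaId_pt g i s) s c hc)
  | zero => rw [map_zero]; exact zero_mem _
  | add a b _ _ ha hb => rw [map_add]; exact add_mem ha hb

/-- The middle convolution of `V` for `λ ≠ 0`. -/
def mcNonzero : LieMod.{u, max u v, max u w} K (Sd g) :=
  LieMod.ofRep (quotRep (lmRep g V lam) (mcSub g V lam) (mcSub_stable g V lam))

end NonZero

/-! ### The middle convolution for `λ = 0` -/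

section Zero

universe u v w

variable {K : Type u} [Field K] {n : ℕ} {𝔤 : Type v} [LieRing 𝔤] [LieAlgebra K 𝔤]
  (g : 𝔤 →ₗ⁅K⁆ DK K n) (V : Type w) [AddCommGroup V] [Module K V] [LieRingModule (Sd g) V]
  [LieModule K (Sd g) V]

variable (K n) in
/-- The space `(⨁_{i=1}^n K ⬝ [x_i, x_{n+1}]) ⊗ V`. -/
abbrev LM0 : Type _ := (Fin n → K) ⊗[K] V

variable (K) in
/-- The map `v ↦ [x_i, x_{n+1}] ⊗ v`. -/
def br (i : Fin n) : V →ₗ[K] LM0 K n V := TensorProduct.mk K _ V (Pi.single i 1)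

variable {V} in
/-- The linear map with `[x_i, x_{n+1}] ⊗ v ↦ φ_i(v)`. -/
def fromLM0 {W : Type*} [AddCommGroup W] [Module K W] (φ : Fin n → V →ₗ[K] W) :
    LM0 K n V →ₗ[K] W :=
  TensorProduct.lift (Fintype.linearCombination K φ)

variable {V} in
@[simp]
theorem fromLM0_br {W : Type*} [AddCommGroup W] [Module K W] (φ : Fin n → V →ₗ[K] W) (i : Fin n)
    (v : V) : fromLM0 φ (br K V i v) = φ i v := by
  simp [fromLM0, br]

variable {V} in
theorem LM0_ext {W : Type*} [AddCommGroup W] [Module K W] {φ ψ : LM0 K n V →ₗ[K] W}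
    (h : ∀ i v, φ (br K V i v) = ψ (br K V i v)) : φ = ψ := by
  apply TensorProduct.ext
  apply LinearMap.pi_ext'
  intro i
  apply LinearMap.ext_ring
  ext v
  exact h i v

/-- Auxiliary representation of `𝕃_n` on `V × LM0`, with
`x_i ⬝ (v, w) = (x_i v, [x_i, x_{n+1}] ⊗ v)`. -/
def foxAux : L K n →ₗ⁅K⁆ Module.End K (V × LM0 K n V) :=
  FreeLieAlgebra.lift K fun i =>
    LinearMap.prod ((actL g V (x K i)).comp (LinearMap.fst K _ _))
      ((br K V i).comp (LinearMap.fst K _ _))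

theorem foxAux_fst (a : L K n) : ∀ u, (foxAux g V a u).1 = actL g V a u.1 := by
  induction a using free_induction with
  | of i => intro u; simp [foxAux]
  | zero => intro u; simp
  | add a b ha hb => intro u; simp [ha, hb]
  | smul t a ha => intro u; simp [ha]
  | lie a b ha hb =>
    intro u
    rw [LieHom.map_lie, LieRing.of_associative_ring_bracket, LinearMap.sub_apply,
      Module.End.mul_apply, Module.End.mul_apply, Prod.fst_sub, ha, hb, hb, ha, actL_lie]

theorem foxAux_snd (a : L K n) (v : V) (w : LM0 K n V) :
    (foxAux g V a (v, w)).2 = (foxAux g V a (v, 0)).2 := by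
  induction a using free_induction generalizing v w with
  | of i => simp [foxAux]
  | zero => simp
  | add a b ha hb => simp [ha v w, hb v w]
  | smul t a ha => simp [ha v w]
  | lie a b ha hb =>
    have h : ∀ u u' : V × LM0 K n V, u.1 = u'.1 →
        (foxAux g V a u).2 = (foxAux g V a u').2 ∧ (foxAux g V b u).2 = (foxAux g V b u').2 := by
      rintro ⟨v, w⟩ ⟨v', w'⟩ rfl
      exact ⟨(ha _ w).trans (ha _ w').symm, (hb _ w).trans (hb _ w').symm⟩
    rw [LieHom.map_lie, LieRing.of_associative_ring_bracket, LinearMap.sub_apply,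
      LinearMap.sub_apply, Prod.snd_sub, Prod.snd_sub]
    simp only [Module.End.mul_apply]
    rw [(h _ (foxAux g V b (v, 0)) (by rw [foxAux_fst, foxAux_fst])).1,
      (h _ (foxAux g V a (v, 0)) (by rw [foxAux_fst, foxAux_fst])).2]

/-- The map `v ↦ [a, x_{n+1}] ⊗ v` for `a ∈ 𝕃_n`, where `[a, x_{n+1}] ⊗ v` is expressed through the
`[x_i, x_{n+1}] ⊗ v` by the rule
`[[a, b], x_{n+1}] ⊗ v = [a, x_{n+1}] ⊗ b v - [b, x_{n+1}] ⊗ a v`,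
which holds in `𝓘 ⊗_U (V ⊗ K_λ)`. -/
def fox : L K n →ₗ[K] (V →ₗ[K] LM0 K n V) where
  toFun a := (LinearMap.snd K _ _).comp ((foxAux g V a).comp (LinearMap.inl K _ _))
  map_add' a b := by ext; simp
  map_smul' t a := by ext; simp

theorem fox_x (i : Fin n) (v : V) : fox g V (x K i) v = br K V i v := by
  change (foxAux g V (x K i) (v, 0)).2 = _
  simp [foxAux]

theorem fox_lie (a b : L K n) (v : V) :
    fox g V ⁅a, b⁆ v = fox g V a (actL g V b v) - fox g V b (actL g V a v) := by
  change (foxAux g V ⁅a, b⁆ (v, 0)).2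
    = (foxAux g V a (actL g V b v, 0)).2 - (foxAux g V b (actL g V a v, 0)).2
  have hb := foxAux_snd g V a (foxAux g V b (v, 0)).1 (foxAux g V b (v, 0)).2
  have ha := foxAux_snd g V b (foxAux g V a (v, 0)).1 (foxAux g V a (v, 0)).2
  rw [foxAux_fst] at ha hb
  rw [LieHom.map_lie, LieRing.of_associative_ring_bracket, LinearMap.sub_apply, Prod.snd_sub,
    Module.End.mul_apply, Module.End.mul_apply, ← ha, ← hb, ← foxAux_fst, ← foxAux_fst]

/-- The map `[x_i, x_{n+1}] ⊗ v ↦ x_i v`. -/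
def mu : LM0 K n V →ₗ[K] V := fromLM0 fun i => actL g V (x K i)

theorem mu_fox (a : L K n) (v : V) : mu g V (fox g V a v) = actL g V a v := by
  induction a using free_induction generalizing v with
  | of i => rw [fox_x, mu, fromLM0_br]
  | zero => simp
  | add a b ha hb => simp [ha, hb]
  | smul t a ha => simp [ha]
  | lie a b ha hb => rw [fox_lie, map_sub, ha, hb, actL_lie]

/-- The action of `a ∈ 𝕃_n` at `λ = 0`, characterized by
`x_j ⬝ ([x_i, x_{n+1}] ⊗ v) = [x_j, x_{n+1}] ⊗ x_i v`. -/
def lm0L (a : L K n) : Module.End K (LM0 K n V) := (fox g V a).comp (mu g V)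

/-- The action of `X ∈ 𝔤` at `λ = 0`:
`X ⬝ ([x_i, x_{n+1}] ⊗ v) = [θ_g(X)(x_i), x_{n+1}] ⊗ v + [x_i, x_{n+1}] ⊗ X v`. -/
def lm0G (X : 𝔤) : Module.End K (LM0 K n V) :=
  fromLM0 fun i => fox g V (thetaOf g X (x K i)) + (br K V i).comp (actG g V X)

theorem lm0G_fox (X : 𝔤) (a : L K n) (v : V) :
    lm0G g V X (fox g V a v) = fox g V (thetaOf g X a) v + fox g V a (actG g V X v) := by
  induction a using free_induction generalizing v with
  | of i => rw [fox_x, fox_x, lm0G, fromLM0_br]; rfl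
  | zero => simp only [map_zero, LinearMap.zero_apply, add_zero]
  | add a b ha hb =>
    rw [map_add, LinearMap.add_apply, map_add, ha, hb, map_add, map_add, LinearMap.add_apply,
      LinearMap.add_apply]
    abel
  | smul t a ha =>
    rw [map_smul, LinearMap.smul_apply, map_smul, ha, map_smul, map_smul, LinearMap.smul_apply,
      LinearMap.smul_apply, smul_add]
  | lie a b ha hb =>
    rw [fox_lie, map_sub, ha, hb, actG_actL, actG_actL, LieDerivation.apply_lie_eq_add]
    simp only [map_add, LinearMap.add_apply, fox_lie]
    abel

theorem mu_lm0G (X : 𝔤) (w : LM0 K n V) : mu g V (lm0G g V X w) = actG g V X (mu g V w) := by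
  have h : (mu g V).comp (lm0G g V X) = (actG g V X).comp (mu g V) := by
    apply LM0_ext
    intro i v
    rw [LinearMap.comp_apply, LinearMap.comp_apply, ← fox_x g, lm0G_fox, map_add, mu_fox, mu_fox,
      mu_fox, actG_actL]
  exact congrArg (fun f => f w) h

/-- The module structure at `λ = 0`: `(a, X)` acts as the sum of the actions of `a` and `X`. -/
def lm0Rep : Sd g →ₗ⁅K⁆ Module.End K (LM0 K n V) where
  toFun s := lm0L g V s.left + lm0G g V s.right
  map_add' s t := by
    apply LM0_ext
    intro i v
    simp only [lm0L, lm0G, LinearMap.add_apply, LinearMap.comp_apply, fromLM0_br,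
      LieAlgebra.SemiDirectSum.add_eq_mk, map_add, LieDerivation.add_apply]
    abel
  map_smul' c s := by
    apply LM0_ext
    intro i v
    simp only [lm0L, lm0G, LinearMap.add_apply, LinearMap.comp_apply, fromLM0_br,
      LieAlgebra.SemiDirectSum.smul_eq_mk, map_smul, LieDerivation.smul_apply,
      LinearMap.smul_apply, RingHom.id_apply, smul_add]
  map_lie' := by
    intro s t
    obtain ⟨a, X⟩ := s
    obtain ⟨b, Y⟩ := t
    have hLL : ∀ w, lm0L g V ⁅a, b⁆ w
        = lm0L g V a (lm0L g V b w) - lm0L g V b (lm0L g V a w) := by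
      intro w
      simp only [lm0L, LinearMap.comp_apply, mu_fox, fox_lie]
    have hGL : ∀ Z c w, lm0G g V Z (lm0L g V c w)
        = lm0L g V (thetaOf g Z c) w + lm0L g V c (lm0G g V Z w) := by
      intro Z c w
      simp only [lm0L, LinearMap.comp_apply, lm0G_fox, mu_lm0G]
    have hGG : lm0G g V ⁅X, Y⁆ = lm0G g V X * lm0G g V Y - lm0G g V Y * lm0G g V X := by
      apply LM0_ext
      intro i v
      rw [← fox_x g, LinearMap.sub_apply, Module.End.mul_apply, Module.End.mul_apply]
      simp only [lm0G_fox, map_add, actG_lie, map_sub, LieHom.map_lie (thetaOf g), LieDerivation.commutator_apply,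
        LinearMap.sub_apply]
      abel
    apply LinearMap.ext
    intro w
    have hGG' : lm0G g V ⁅X, Y⁆ w = lm0G g V X (lm0G g V Y w) - lm0G g V Y (lm0G g V X w) := by
      rw [hGG]; rfl
    have hadd : ∀ c d, lm0L g V (c + d) w = lm0L g V c w + lm0L g V d w := by
      intro c d; simp only [lm0L, map_add, LinearMap.comp_apply, LinearMap.add_apply]
    have hsub : ∀ c d, lm0L g V (c - d) w = lm0L g V c w - lm0L g V d w := by
      intro c d; simp only [lm0L, map_sub, LinearMap.comp_apply, LinearMap.sub_apply]
    simp only [LieAlgebra.SemiDirectSum.lie_eq_mk, LieRing.of_associative_ring_bracket,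
      LinearMap.add_apply, LinearMap.sub_apply, Module.End.mul_apply, map_add, hadd, hsub, hLL,
      hGG', hGL]
    abel

/-- The subspace of `𝕃_n`-invariants. -/
def lm0Inv : Submodule K (LM0 K n V) :=
  ⨅ a : L K n, LinearMap.ker (lm0Rep g V (inL g a))

/-- The subspace `∑_i K ⬝ [x_i, x_{n+1}] ⊗ V^{x_i} + LM0^{𝕃_n}`, where `V^{x_i}` is the kernel of
`x_i` on `V`. -/
def mc0Sub : Submodule K (LM0 K n V) :=
  (⨆ i : Fin n, (LinearMap.ker (actL g V (x K i))).map (br K V i)) ⊔ lm0Inv g V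

theorem mc0Sub_stable (s : Sd g) (c : LM0 K n V) (hc : c ∈ mc0Sub g V) :
    lm0Rep g V s c ∈ mc0Sub g V := by
  have hker : ∀ i : Fin n, ∀ v, actL g V (x K i) v = 0 → br K V i v ∈ mc0Sub g V := fun i v hv =>
    le_sup_left (a := ⨆ i : Fin n, (LinearMap.ker (actL g V (x K i))).map (br K V i))
      (Submodule.mem_iSup_of_mem i (Submodule.mem_map_of_mem hv))
  obtain ⟨u, hu, w, hw, rfl⟩ := Submodule.mem_sup.1 hc
  rw [map_add]
  refine add_mem ?_ ?_
  · clear hc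
    induction hu using Submodule.iSup_induction' with
    | mem i u hu =>
      obtain ⟨v, hv, rfl⟩ := hu
      have hv : actL g V (x K i) v = 0 := hv
      obtain ⟨b, hb⟩ := theta_x (g s.right) i
      have hb : thetaOf g s.right (x K i) = ⁅x K i, b⁆ := hb
      have h : lm0Rep g V s (br K V i v) = br K V i (actL g V b v + actG g V s.right v) := by
        change lm0L g V s.left (br K V i v) + lm0G g V s.right (br K V i v) = _
        rw [lm0L, LinearMap.comp_apply, mu, fromLM0_br, hv, map_zero, zero_add, ← fox_x g,
          lm0G_fox, hb, fox_lie, hv, map_zero, sub_zero, ← map_add, fox_x]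
      rw [h]
      apply hker
      have h1 := actG_actL g V s.right (x K i) v
      rw [hb, actL_lie, hv, map_zero, map_zero, sub_zero] at h1
      rw [map_add, ← h1]
    | zero => rw [map_zero]; exact zero_mem _
    | add a b _ _ ha hb =>
      rw [map_add]
      exact add_mem ha hb
  · refine le_sup_right (b := lm0Inv g V) ?_
    rw [lm0Inv, Submodule.mem_iInf] at hw ⊢
    intro a
    have h : ⁅inL g a, s⁆ = inL g (⁅a, s.left⁆ - thetaOf g s.right a) := by
      simp
    have h2 : lm0Rep g V (inL g a) (lm0Rep g V s w)
        = lm0Rep g V ⁅inL g a, s⁆ w + lm0Rep g V s (lm0Rep g V (inL g a) w) := by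
      rw [LieHom.map_lie, LieRing.of_associative_ring_bracket, LinearMap.sub_apply]
      simp [Module.End.mul_apply]
    rw [LinearMap.mem_ker, h2, h, LinearMap.mem_ker.1 (hw _), LinearMap.mem_ker.1 (hw _),
      map_zero, add_zero]

/-- The middle convolution of `V` for `λ = 0`. -/
def mcZero : LieMod.{u, max u v, max u w} K (Sd g) :=
  LieMod.ofRep (quotRep (lm0Rep g V) (mc0Sub g V) (mc0Sub_stable g V))

end Zero

/-! ### The middle convolution -/

section Main

universe u v w

variable {K : Type u} [Field K] {n : ℕ} {𝔤 : Type v} [LieRing 𝔤] [LieAlgebra K 𝔤]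
  (g : 𝔤 →ₗ⁅K⁆ DK K n)

open scoped Classical in
/-- The middle convolution `𝔪𝔠_λ(V)`. -/
def mc (lam : K) (V : LieMod.{u, max u v, w} K (Sd g)) : LieMod.{u, max u v, max u w} K (Sd g) :=
  if lam = 0 then mcZero g V.carrier else mcNonzero g V.carrier lam

/-- The condition `V^{x_i - c} ∩ ⋂_{j ≠ i} V^{x_j} = 0` for all `c ∈ K` and all `i`. -/
def CondStar (V : LieMod.{u, max u v, w} K (Sd g)) : Prop :=
  ∀ (c : K) (i : Fin n),
    LinearMap.ker (actL g V.carrier (x K i) - c • 1)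
      ⊓ ⨅ (j : Fin n) (_ : j ≠ i), LinearMap.ker (actL g V.carrier (x K j)) = ⊥

/-- The condition `(x_i - c) V + ∑_{j ≠ i} x_j V = V` for all `c ∈ K` and all `i`. -/
def CondStarStar (V : LieMod.{u, max u v, w} K (Sd g)) : Prop :=
  ∀ (c : K) (i : Fin n),
    LinearMap.range (actL g V.carrier (x K i) - c • 1)
      ⊔ ⨆ (j : Fin n) (_ : j ≠ i), LinearMap.range (actL g V.carrier (x K j)) = ⊤

end Main

end

end MidConv

namespace MidConv

open scoped TensorProduct

noncomputable section

attribute [local instance 100] LieRing.ofAssociativeRing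

/-! ### Irreducibility in terms of generators -/

section Criterion

variable {K : Type*} [Field K] {ι E Q : Type*} [AddCommGroup E] [Module K E] [AddCommGroup Q]
  [Module K Q]

/-! Write `A_i` for the action of `x_i` on `V`. Each middle convolution is a quotient of an explicit
vector space, and only the operators by which `x_1, …, x_n` act on it matter for irreducibility over
`𝕃_n`. `SimpleOver` expresses irreducibility of such a quotient upstairs, so that two quotients of
one space can be compared through their kernels.

For `λ = 0` the map `mu`, sending `[x_i, x_{n+1}] ⊗ v` to `x_i v`, is equivariant, surjective by
(**), and its kernel is exactly the subspace divided out (`mc0Sub_eq_ker_mu`). Hence `𝔪𝔠_0(V) ≅ V`.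

For `λ ≠ 0`, freeness of `𝕃_{n+1}` identifies `H_1(𝕃_{n+1}, V ⊗ K_λ)` with `V^n` via `fromTuple`.
There `x_j` acts as `w ↦ φ_j(w) e_j` with `φ_j(w) = λ w_j + ∑ A_i w_i` (`fromTuple_convOp`), and the
subspace divided out is `{w | A_j φ_j(w) = 0 for all j}` (`fromTuple_mem_mcSub`,
`coord_mem_convKer`). What remains is linear algebra. An invariant `W ⊆ V^n` has a trace `T(W) = ∑
A_j φ_j(W)`, an invariant subspace of `V`. It vanishes exactly when `W ≤ convKer`, and `T(W) = V`
forces `W = V^n`. So irreducibility passes from `V` to the quotient, which is nonzero because (**)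
gives `T(V^n) = V`. Conversely, an invariant `U ⊆ V` gives the invariant subspace `U^n + convKer`:
if this is `convKer`, then (*) yields `U = 0`; if it is everything, taking traces yields `U = V`.

The last assertion is formal: irreducibility over the subalgebra `𝕃_n` implies irreducibility over
the semidirect sum. -/

/-- The operators `B_j` on `E` have `N ≠ E`, and no invariant subspace lies strictly between `N` and
`E`. If `N` is invariant this says that `E / N` is irreducible. -/
def SimpleOver (B : ι → Module.End K E) (N : Submodule K E) : Prop :=
  N ≠ ⊤ ∧ ∀ W : Submodule K E, N ≤ W → (∀ j, ∀ e ∈ W, B j e ∈ W) → W = N ∨ W = ⊤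

/-- Invariant subspaces of `Q` correspond, by preimage, to invariant subspaces of `E` containing the
kernel. Two quotients of the same `E` can then be compared through an equality of kernels, without
building an isomorphism between them. -/
theorem simpleOver_bot_iff {B : ι → Module.End K E} {C : ι → Module.End K Q} (P : E →ₗ[K] Q)
    (hP : Function.Surjective P) (h : ∀ j e, P (B j e) = C j (P e)) :
    SimpleOver C ⊥ ↔ SimpleOver B (LinearMap.ker P) := by
  have hcomap : ∀ U : Submodule K Q, (U.comap P).map P = U := fun U =>
    Submodule.map_comap_eq_of_surjective hP U
  constructor
  · rintro ⟨h0, h1⟩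
    refine ⟨fun hk => h0 ?_, fun W hW hB => ?_⟩
    · rw [← hcomap ⊥, ← LinearMap.ker, hk, Submodule.map_top, LinearMap.range_eq_top.2 hP] at h0
      exact absurd rfl h0
    · have hW' : (W.map P).comap P = W := by
        rw [Submodule.comap_map_eq, sup_eq_left.2 hW]
      rcases h1 (W.map P) bot_le (by
        rintro j _ ⟨e, he, rfl⟩
        exact ⟨_, hB j e he, h j e⟩) with h2 | h2
      · left; rw [← hW', h2]; rfl
      · right; rw [← hW', h2, Submodule.comap_top]
  · rintro ⟨h0, h1⟩
    refine ⟨fun hk => h0 ?_, fun U _ hC => ?_⟩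
    · rw [LinearMap.ker, hk, Submodule.comap_top]
    · rcases h1 (U.comap P) (Submodule.comap_mono bot_le) (fun j e he => by
        rw [Submodule.mem_comap, h]
        exact hC j _ he) with h2 | h2
      · left; rw [← hcomap U, h2, LinearMap.ker, hcomap]
      · right; rw [← hcomap U, h2, Submodule.map_top, LinearMap.range_eq_top.2 hP]

/-- The elements stabilising a given subspace form a Lie subalgebra, so stability under the free
generators is enough. -/
theorem isIrreducible_iff_simpleOver {n : ℕ} (V : LieMod K (L K n)) :
    V.IsIrreducible ↔ SimpleOver (fun j => LieModule.toEnd K (L K n) V.carrier (x K j)) ⊥ := by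
  constructor
  · intro hV
    have hV : LieModule.IsIrreducible K (L K n) V.carrier := hV
    refine ⟨fun h => ?_, fun W _ hW => ?_⟩
    · have := LieModule.nontrivial_of_isIrreducible K (L K n) V.carrier
      exact bot_ne_top h
    · have hW' : ∀ (a : L K n) (w : V.carrier), w ∈ W → ⁅a, w⁆ ∈ W := by
        intro a
        induction a using free_induction with
        | of i => exact hW i
        | zero => intro w _; rw [zero_lie]; exact zero_mem _
        | add a b ha hb => intro w hw; rw [add_lie]; exact add_mem (ha w hw) (hb w hw)
        | smul t a ha => intro w hw; rw [smul_lie]; exact W.smul_mem _ (ha w hw)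
        | lie a b ha hb =>
          intro w hw
          rw [lie_lie]
          exact sub_mem (ha _ (hb w hw)) (hb _ (ha w hw))
      rcases IsSimpleOrder.eq_bot_or_eq_top
        ({ W with lie_mem := fun {a w} hw => hW' a w hw } : LieSubmodule K (L K n) V.carrier)
        with h | h
      · left; simpa using congrArg LieSubmodule.toSubmodule h
      · right; simpa using congrArg LieSubmodule.toSubmodule h
  · rintro ⟨h0, h1⟩
    have : Nontrivial V.carrier := (Submodule.nontrivial_iff K).1 ⟨_, _, h0⟩
    refine LieModule.IsIrreducible.mk fun W hW => ?_
    rcases h1 W bot_le (fun j w hw => W.lie_mem hw) with h | h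
    · exact absurd ((LieSubmodule.toSubmodule_eq_bot W).1 h) hW
    · exact (LieSubmodule.toSubmodule_eq_top _).1 h

/-- Every `S`-submodule is also an `S'`-submodule, so there are at most as many of them. -/
theorem LieMod.IsIrreducible.of_res {S S' : Type*} [LieRing S] [LieAlgebra K S] [LieRing S']
    [LieAlgebra K S'] {f : S' →ₗ⁅K⁆ S} {V : LieMod K S} (h : (V.res f).IsIrreducible) :
    V.IsIrreducible := by
  have h : LieModule.IsIrreducible K S' (V.res f).carrier := h
  have hn : Nontrivial V.carrier := LieModule.nontrivial_of_isIrreducible K S' (V.res f).carrier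
  refine LieModule.IsIrreducible.mk fun W hW => ?_
  have hlie : ∀ {a : S'} {w : V.carrier}, w ∈ W → ⁅f a, w⁆ ∈ W := fun hw => W.lie_mem hw
  let W' : LieSubmodule K S' (V.res f).carrier :=
    { W.toSubmodule with lie_mem := fun {a w} hw => hlie hw }
  rcases IsSimpleOrder.eq_bot_or_eq_top W' with h | h
  · exact absurd ((LieSubmodule.toSubmodule_eq_bot W).1 (congrArg LieSubmodule.toSubmodule h)) hW
  · exact (LieSubmodule.toSubmodule_eq_top _).1 (congrArg LieSubmodule.toSubmodule h)

end Criterion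

/-! ### Convolution of tuples of endomorphisms -/

section Tuple

variable {K : Type*} [Field K] {ι V : Type*} [Fintype ι] [AddCommGroup V] [Module K V]

/-- The map `w ↦ ∑_i A_i w_i`. -/
def colSum (A : ι → Module.End K V) : (ι → V) →ₗ[K] V :=
  ∑ i, (A i).comp (LinearMap.proj i)

theorem colSum_apply (A : ι → Module.End K V) (w : ι → V) : colSum A w = ∑ i, A i (w i) := by
  simp [colSum]

/-- The map `w ↦ λ w_j + ∑_i A_i w_i`. -/
def convRow (A : ι → Module.End K V) (lam : K) (j : ι) : (ι → V) →ₗ[K] V :=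
  lam • LinearMap.proj j + colSum A

theorem convRow_apply (A : ι → Module.End K V) (lam : K) (j : ι) (w : ι → V) :
    convRow A lam j w = lam • w j + colSum A w := rfl

/-- The kernel of `w ↦ (A_j (λ w_j + ∑_i A_i w_i))_j`. -/
def convKer (A : ι → Module.End K V) (lam : K) : Submodule K (ι → V) :=
  ⨅ j, LinearMap.ker ((A j).comp (convRow A lam j))

theorem mem_convKer {A : ι → Module.End K V} {lam : K} {w : ι → V} :
    w ∈ convKer A lam ↔ ∀ j, A j (convRow A lam j w) = 0 := by
  simp [convKer]

/-- The subspace `∑_j A_j φ_j(W)`, where `φ_j` is `convRow A lam j`. -/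
def convTrace (A : ι → Module.End K V) (lam : K) (W : Submodule K (ι → V)) : Submodule K V :=
  ⨆ j, W.map ((A j).comp (convRow A lam j))

theorem convTrace_eq_bot {A : ι → Module.End K V} {lam : K} {W : Submodule K (ι → V)} :
    convTrace A lam W = ⊥ ↔ W ≤ convKer A lam := by
  rw [← le_bot_iff, convTrace, convKer, iSup_le_iff, le_iInf_iff]
  exact forall_congr' fun j => Submodule.map_le_iff_le_comap

theorem convTrace_sup (A : ι → Module.End K V) (lam : K) (W W' : Submodule K (ι → V)) :
    convTrace A lam (W ⊔ W') = convTrace A lam W ⊔ convTrace A lam W' := by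
  simp only [convTrace, Submodule.map_sup, iSup_sup_eq]

/-! ### Convolution operators, and passage between invariant subspaces of `V^ι` and of `V` -/

variable [DecidableEq ι]

/-- The operators `w ↦ (λ w_j + ∑_i A_i w_i) e_j`. -/
def convOp (A : ι → Module.End K V) (lam : K) (j : ι) : Module.End K (ι → V) :=
  (LinearMap.single K (fun _ => V) j).comp (convRow A lam j)

theorem convOp_apply (A : ι → Module.End K V) (lam : K) (j : ι) (w : ι → V) :
    convOp A lam j w = Pi.single j (convRow A lam j w) := rfl

theorem colSum_single (A : ι → Module.End K V) (i : ι) (v : V) :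
    colSum A (Pi.single i v) = A i v := by
  rw [colSum_apply, Finset.sum_eq_single i]
  · simp
  · intro j _ hj; simp [hj]
  · simp

theorem convRow_single (A : ι → Module.End K V) (lam : K) (j i : ι) (v : V) :
    convRow A lam j (Pi.single i v) = (if j = i then lam • v else 0) + A i v := by
  rw [convRow_apply, colSum_single, Pi.single_apply]
  split_ifs <;> simp

theorem mem_of_forall_single_mem {W : Submodule K (ι → V)} (h : ∀ i v, Pi.single i v ∈ W) :
    W = ⊤ := by
  refine eq_top_iff.2 fun w _ => ?_
  rw [← Finset.univ_sum_single w]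
  exact sum_mem fun i _ => h i _

/-- Apply `A_j φ_j` to `φ_i(w) e_i ∈ W`. The result is `A_j A_i φ_i(w)` plus, when `i = j`, the term
`λ A_j φ_j(w)`, which already lies in the trace. -/
theorem convTrace_stable (A : ι → Module.End K V) (lam : K) {W : Submodule K (ι → V)}
    (hW : ∀ j, ∀ w ∈ W, convOp A lam j w ∈ W) (j : ι) (v : V) (hv : v ∈ convTrace A lam W) :
    A j v ∈ convTrace A lam W := by
  have hmem : ∀ i, ∀ w ∈ W, A i (convRow A lam i w) ∈ convTrace A lam W := fun i w hw =>
    Submodule.mem_iSup_of_mem i ⟨w, hw, rfl⟩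
  induction hv using Submodule.iSup_induction' with
  | mem i v hv =>
    obtain ⟨w, hw, rfl⟩ := hv
    have h := hmem j _ (hW i w hw)
    rw [convOp_apply, convRow_single, map_add] at h
    refine (Submodule.add_mem_iff_right _ ?_).1 h
    split_ifs with hji
    · subst hji
      rw [map_smul]
      exact Submodule.smul_mem _ _ (hmem _ w hw)
    · rw [map_zero]; exact zero_mem _
  | zero => rw [map_zero]; exact zero_mem _
  | add a b _ _ ha hb => rw [map_add]; exact add_mem ha hb

/-- If `u e_i ∈ W`, applying the `j`-th operator puts `(A_i u) e_j` in `W` for every `j`. With `u =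
φ_i(w)` this shows that `W` contains a copy of its trace in each coordinate. -/
theorem eq_top_of_convTrace_eq_top (A : ι → Module.End K V) (lam : K) {W : Submodule K (ι → V)}
    (hW : ∀ j, ∀ w ∈ W, convOp A lam j w ∈ W) (h : convTrace A lam W = ⊤) : W = ⊤ := by
  refine mem_of_forall_single_mem fun j v => ?_
  have hA : ∀ i u, Pi.single i u ∈ W → Pi.single (M := fun _ => V) j (A i u) ∈ W := by
    intro i u hu
    have h1 := hW j _ hu
    rw [convOp_apply, convRow_single, Pi.single_add] at h1
    refine (Submodule.add_mem_iff_right _ ?_).1 h1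
    split_ifs with hji
    · subst hji
      rw [Pi.single_smul]
      exact W.smul_mem _ hu
    · rw [Pi.single_zero]; exact zero_mem _
  have hle : convTrace A lam W ≤ W.comap (LinearMap.single K (fun _ => V) j) := by
    refine iSup_le fun i => ?_
    rintro _ ⟨w, hw, rfl⟩
    exact hA i _ (hW i w hw)
  exact hle (h ▸ Submodule.mem_top : v ∈ convTrace A lam W)

/-- Two instances of (**) are needed: one makes every `φ_j` surjective, the other makes the images
of the `A_j` span `V`. -/
theorem convTrace_top [Nonempty ι] {A : ι → Module.End K V} (lam : K)
    (hA : ∀ (c : K) (i : ι), LinearMap.range (A i - c • 1)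
      ⊔ ⨆ (j : ι) (_ : j ≠ i), LinearMap.range (A j) = ⊤) : convTrace A lam ⊤ = ⊤ := by
  have hrow : ∀ j, LinearMap.range (convRow A lam j) = ⊤ := by
    intro j
    -- On the `j`-th coordinate `φ_j` is `A_j + λ`, on the `i`-th it is `A_i`; this is (**) with `c
    -- = -λ`.
    rw [eq_top_iff, ← hA (-lam) j]
    refine sup_le ?_ (iSup₂_le fun i hi => ?_)
    · rintro _ ⟨v, rfl⟩
      refine ⟨Pi.single j v, ?_⟩
      rw [convRow_single, if_pos rfl]
      simp [add_comm]
    · rintro _ ⟨v, rfl⟩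
      refine ⟨Pi.single i v, ?_⟩
      rw [convRow_single, if_neg hi.symm, zero_add]
  have hle : ∀ i, LinearMap.range (A i) ≤ convTrace A lam ⊤ := by
    intro i
    refine le_trans (le_of_eq ?_) (le_iSup _ i)
    rw [Submodule.map_comp, Submodule.map_top, hrow, Submodule.map_top]
  obtain ⟨i⟩ := ‹Nonempty ι›
  rw [eq_top_iff, ← hA 0 i, zero_smul, sub_zero]
  exact sup_le (hle i) (iSup₂_le fun j _ => hle j)

/-- The trace of an invariant subspace is `0` or `V`, and these two values detect the two permitted
subspaces. Condition (**) serves only to make the quotient nonzero. -/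
theorem simpleOver_convKer [Nonempty ι] {A : ι → Module.End K V} (lam : K)
    (hA : ∀ (c : K) (i : ι), LinearMap.range (A i - c • 1)
      ⊔ ⨆ (j : ι) (_ : j ≠ i), LinearMap.range (A j) = ⊤)
    (h : SimpleOver A ⊥) : SimpleOver (convOp A lam) (convKer A lam) := by
  refine ⟨fun hk => h.1 ?_, fun W hN hW => ?_⟩
  · rw [← convTrace_top lam hA, convTrace_eq_bot.2 hk.ge]
  · rcases h.2 (convTrace A lam W) bot_le (convTrace_stable A lam hW) with h1 | h1
    · exact Or.inl (le_antisymm (convTrace_eq_bot.1 h1) hN)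
    · exact Or.inr (eq_top_of_convTrace_eq_top A lam hW h1)

/-- An invariant `U ⊆ V` is tested through `U^ι + convKer`; both conditions are needed to recover
`U` from the answer. -/
theorem simpleOver_of_convKer [Nonempty ι] {A : ι → Module.End K V} (lam : K)
    (hA' : ∀ (c : K) (i : ι), LinearMap.ker (A i - c • 1)
      ⊓ ⨅ (j : ι) (_ : j ≠ i), LinearMap.ker (A j) = ⊥)
    (hA : ∀ (c : K) (i : ι), LinearMap.range (A i - c • 1)
      ⊔ ⨆ (j : ι) (_ : j ≠ i), LinearMap.range (A j) = ⊤)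
    (h : SimpleOver (convOp A lam) (convKer A lam)) : SimpleOver A ⊥ := by
  have hzero : ∀ (c : K) (i : ι) (v : V), A i v = c • v → (∀ j, j ≠ i → A j v = 0) → v = 0 := by
    intro c i v hi hj
    rw [← Submodule.mem_bot K, ← hA' c i]
    simp only [Submodule.mem_inf, Submodule.mem_iInf, LinearMap.mem_ker]
    exact ⟨by simp [hi], hj⟩
  refine ⟨fun hk => h.1 (eq_top_iff.2 ?_), fun U _ hU => ?_⟩
  · rw [← convTrace_eq_bot, eq_bot_iff, hk]
    exact le_top
  · have hrow : ∀ j, ∀ w ∈ Submodule.pi Set.univ (fun _ : ι => U), convRow A lam j w ∈ U := by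
      intro j w hw
      have hw : ∀ i, w i ∈ U := fun i => hw i trivial
      rw [convRow_apply, colSum_apply]
      exact add_mem (U.smul_mem _ (hw j)) (sum_mem fun i _ => hU i _ (hw i))
    have hstable : ∀ j, ∀ w ∈ Submodule.pi Set.univ (fun _ : ι => U) ⊔ convKer A lam,
        convOp A lam j w ∈ Submodule.pi Set.univ (fun _ : ι => U) ⊔ convKer A lam := by
      intro j w hw
      obtain ⟨u, hu, k, hk, rfl⟩ := Submodule.mem_sup.1 hw
      rw [map_add]
      refine add_mem (Submodule.mem_sup_left ?_) (Submodule.mem_sup_right ?_)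
      · intro i _
        rw [convOp_apply, Pi.single_apply]
        split_ifs
        · exact hrow j u hu
        · exact zero_mem _
      -- `convKer` is itself invariant: `φ_i(φ_j(k) e_j)` is `λ φ_j(k)` if `i = j` and `0`
      -- otherwise, since `A_j φ_j(k) = 0`.
      · rw [mem_convKer] at hk ⊢
        intro i
        rw [convOp_apply, convRow_single, hk, add_zero]
        split_ifs with hij
        · subst hij; rw [map_smul, hk, smul_zero]
        · rw [map_zero]
    rcases h.2 _ le_sup_right hstable with h1 | h1
    · left
      rw [eq_bot_iff]
      intro u hu
      have hs : ∀ j k, A j ((if j = k then lam • u else 0) + A k u) = 0 := by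
        intro j k
        rw [← convRow_single]
        refine mem_convKer.1 (h1 ▸ Submodule.mem_sup_left fun i _ => ?_) j
        rw [Pi.single_apply]
        split_ifs
        · exact hu
        · exact zero_mem _
      -- Here `U^ι ≤ convKer`. So `A_k u` is an eigenvector of `A_k` for `-λ` killed by all other
      -- `A_j`, and (*) with `c = -λ` kills it. A second use of (*), with `c = 0`, then gives `u =
      -- 0`.
      have hk : ∀ k, A k u = 0 := by
        intro k
        refine hzero (-lam) k _ ?_ fun j hj => ?_
        · have := hs k k
          rw [if_pos rfl, map_add, map_smul] at this
          rw [neg_smul]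
          exact eq_neg_of_add_eq_zero_right this
        · have := hs j k
          rwa [if_neg hj, zero_add] at this
      obtain ⟨i⟩ := ‹Nonempty ι›
      exact hzero 0 i u (by rw [hk, zero_smul]) fun j _ => hk j
    · right
      -- Take traces of `U^ι + convKer = V^ι`: the left side contributes only the trace of `U^ι`,
      -- which lies in `U`, while the right side has trace `V`.
      rw [eq_top_iff, ← convTrace_top lam hA, ← h1, convTrace_sup, convTrace_eq_bot.2 le_rfl,
        sup_bot_eq]
      refine iSup_le fun j => ?_
      rintro _ ⟨w, hw, rfl⟩
      exact hU j _ (hrow j w hw)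

end Tuple

/-! ### Irreducibility over `𝕃_n` -/

section Restrict

universe u v w

variable {K : Type u} [Field K] {n : ℕ} {𝔤 : Type v} [LieRing 𝔤] [LieAlgebra K 𝔤]
  (g : 𝔤 →ₗ⁅K⁆ DK K n)

theorem res_isIrreducible_iff (V : LieMod K (Sd g)) :
    (V.res (inL g)).IsIrreducible ↔ SimpleOver (fun j => actL g V.carrier (x K j)) ⊥ :=
  isIrreducible_iff_simpleOver (V.res (inL g))

theorem ofRep_res_isIrreducible_iff {E : Type w} [AddCommGroup E] [Module K E]
    (r : Sd g →ₗ⁅K⁆ Module.End K E) :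
    ((LieMod.ofRep r).res (inL g)).IsIrreducible ↔
      SimpleOver (fun j => r (inL g (x K j))) ⊥ :=
  isIrreducible_iff_simpleOver ((LieMod.ofRep r).res (inL g))

end Restrict

/-! ### The case `λ = 0` -/

section Zero

universe u v w

variable {K : Type u} [Field K] {n : ℕ} {𝔤 : Type v} [LieRing 𝔤] [LieAlgebra K 𝔤]
  (g : 𝔤 →ₗ⁅K⁆ DK K n) (V : Type w) [AddCommGroup V] [Module K V] [LieRingModule (Sd g) V]
  [LieModule K (Sd g) V]

theorem lm0Rep_inL (a : L K n) (w : LM0 K n V) :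
    lm0Rep g V (inL g a) w = fox g V a (mu g V w) := by
  change lm0L g V a w + lm0G g V 0 w = _
  have h0 : lm0G g V 0 = 0 := by
    apply LM0_ext
    intro i v
    rw [lm0G, fromLM0_br, map_zero, map_zero]
    simp
  rw [h0, LinearMap.zero_apply, add_zero]
  rfl

theorem br_injective (i : Fin n) : Function.Injective (br K V i) := by
  intro v v' h
  simpa using congrArg (fromLM0 fun _ => LinearMap.id (R := K) (M := V)) h

/-- Each `x_j` acts as `mu` followed by the injective map `v ↦ [x_j, x_{n+1}] ⊗ v`. Hence the
`𝕃_n`-invariants already make up all of `ker mu`, and the summands from `V^{x_i}` add nothing. -/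
theorem mc0Sub_eq_ker_mu (hn : 1 ≤ n) : mc0Sub g V = LinearMap.ker (mu g V) := by
  apply le_antisymm
  · refine sup_le (iSup_le fun i => ?_) fun w hw => ?_
    · rintro _ ⟨v, hv, rfl⟩
      rw [LinearMap.mem_ker, mu, fromLM0_br]
      exact hv
    · rw [lm0Inv, Submodule.mem_iInf] at hw
      -- Any single generator suffices; `n ≥ 1` provides one.
      have h := hw (x K ⟨0, hn⟩)
      rw [LinearMap.mem_ker, lm0Rep_inL, fox_x] at h
      exact br_injective V _ (h.trans (map_zero _).symm)
  · refine le_trans (fun w hw => ?_) le_sup_right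
    rw [lm0Inv, Submodule.mem_iInf]
    intro a
    rw [LinearMap.mem_ker, lm0Rep_inL, LinearMap.mem_ker.1 hw, map_zero]

/-- Both `V` and `𝔪𝔠_0(V)` are quotients of the same space by `ker mu`; (**) with `c = 0` is the
surjectivity of `mu`. -/
theorem mcZero_isIrreducible_iff (hn : 1 ≤ n) (V : LieMod.{u, max u v, w} K (Sd g))
    (hV : CondStarStar g V) :
    (V.res (inL g)).IsIrreducible ↔ ((mcZero g V.carrier).res (inL g)).IsIrreducible := by
  have hsurj : Function.Surjective (mu g V.carrier) := by
    rw [← LinearMap.range_eq_top, eq_top_iff, ← hV 0 ⟨0, hn⟩, zero_smul, sub_zero]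
    have h : ∀ i,
        LinearMap.range (actL g V.carrier (x K i)) ≤ LinearMap.range (mu g V.carrier) := by
      rintro i _ ⟨v, rfl⟩
      exact ⟨br K _ i v, fromLM0_br _ _ _⟩
    exact sup_le (h _) (iSup₂_le fun j _ => h j)
  rw [res_isIrreducible_iff, mcZero, ofRep_res_isIrreducible_iff,
    simpleOver_bot_iff (B := fun j => lm0Rep g V.carrier (inL g (x K j))) (mu g V.carrier) hsurj
      (fun j e => by rw [lm0Rep_inL, mu_fox]),
    simpleOver_bot_iff (B := fun j => lm0Rep g V.carrier (inL g (x K j)))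
      (mc0Sub g V.carrier).mkQ (Submodule.mkQ_surjective _) (fun j e => rfl),
    Submodule.ker_mkQ, mc0Sub_eq_ker_mu g V.carrier hn]

end Zero

/-! ### Coordinates on `𝓘 ⊗_U M` for a free Lie algebra -/

section Coord

variable {K : Type*} [Field K] {X : Type*} [DecidableEq X] {M : Type*} [AddCommGroup M]
  [Module K M] (ρ : FreeLieAlgebra K X →ₗ⁅K⁆ Module.End K M)

/-- The representation of the free Lie algebra on `M × (X → M)` with
`x_i ⬝ (m, u) = (x_i m, m e_i)`. -/
def coordAux : FreeLieAlgebra K X →ₗ⁅K⁆ Module.End K (M × (X → M)) :=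
  FreeLieAlgebra.lift K fun i =>
    LinearMap.prod ((ρ (FreeLieAlgebra.of K i)).comp (LinearMap.fst K _ _))
      ((LinearMap.single K (fun _ => M) i).comp (LinearMap.fst K _ _))

/-- The generators read only the `M`-component of a pair. This is what makes the second component of
`[a, b]` obey the defining relation of `𝓘 ⊗_U M`, so that `coord` descends to the quotient. -/
theorem coordAux_apply (a : FreeLieAlgebra K X) :
    ∀ u, (coordAux ρ a u).1 = ρ a u.1 ∧ (coordAux ρ a u).2 = (coordAux ρ a (u.1, 0)).2 := by
  induction a using free_induction with
  | of i => intro u; simp [coordAux]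
  | zero => intro u; simp
  | add a b ha hb => intro u; simp [(ha u).1, (hb u).1, (ha u).2, (hb u).2]
  | smul t a ha => intro u; simp [(ha u).1, (ha u).2]
  | lie a b ha hb =>
    intro u
    rw [LieHom.map_lie, LieHom.map_lie, LieRing.of_associative_ring_bracket,
      LieRing.of_associative_ring_bracket, LinearMap.sub_apply, LinearMap.sub_apply,
      LinearMap.sub_apply]
    simp only [Module.End.mul_apply, Prod.fst_sub, Prod.snd_sub, (ha _).1, (hb _).1]
    refine ⟨trivial, ?_⟩
    rw [(ha (coordAux ρ b u)).2, (ha (coordAux ρ b (u.1, 0))).2, (hb (coordAux ρ a u)).2,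
      (hb (coordAux ρ a (u.1, 0))).2, (ha _).1, (ha _).1, (hb _).1, (hb _).1]

/-- The coordinates of an element of `𝓘 ⊗_U M = ⨁_i x_i ⊗ M`. -/
def coord : Coker ρ →ₗ[K] (X → M) :=
  (bdry ρ).liftQ (TensorProduct.lift
    { toFun := fun a => (LinearMap.snd K M (X → M)).comp
        ((coordAux ρ a).comp (LinearMap.inl K M (X → M)))
      map_add' := fun a b => by ext; simp
      map_smul' := fun t a => by ext; simp }) (by
    refine Submodule.span_le.2 ?_
    rintro _ ⟨a, b, m, rfl⟩
    have h : (coordAux ρ ⁅a, b⁆ (m, 0)).2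
        = (coordAux ρ a (ρ b m, 0)).2 - (coordAux ρ b (ρ a m, 0)).2 := by
      rw [LieHom.map_lie, LieRing.of_associative_ring_bracket, LinearMap.sub_apply,
        Module.End.mul_apply, Module.End.mul_apply, Prod.snd_sub, (coordAux_apply ρ a _).2,
        (coordAux_apply ρ b _).2, (coordAux_apply ρ a _).1, (coordAux_apply ρ b _).1]
    rw [SetLike.mem_coe, LinearMap.mem_ker, map_add, map_sub]
    change (coordAux ρ ⁅a, b⁆ (m, 0)).2 - (coordAux ρ a (ρ b m, 0)).2
      + (coordAux ρ b (ρ a m, 0)).2 = 0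
    rw [h]
    abel)

theorem coord_cls_of (i : X) (m : M) :
    coord ρ (cls ρ (FreeLieAlgebra.of K i) m) = Pi.single i m := by
  change (coordAux ρ (FreeLieAlgebra.of K i) (m, 0)).2 = _
  simp [coordAux]

/-- The relation `[a, b] ⊗ m = a ⊗ b m - b ⊗ a m` rewrites every class through the generators.
Together with `coord`, which shows such an expression to be unique, this is the freeness of `𝓘` as a
right module. -/
theorem exists_eq_sum_cls [Fintype X] (c : Coker ρ) :
    ∃ u : X → M, c = ∑ i, cls ρ (FreeLieAlgebra.of K i) (u i) := by
  let Φ : (X → M) →ₗ[K] Coker ρ := ∑ i, ((bdry ρ).mkQ.comp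
    (TensorProduct.mk K _ M (FreeLieAlgebra.of K i))).comp (LinearMap.proj i)
  have hΦ : ∀ u, Φ u = ∑ i, cls ρ (FreeLieAlgebra.of K i) (u i) := fun u => by simp [Φ]
  have hcls : ∀ a m, cls ρ a m ∈ LinearMap.range Φ := by
    intro a
    induction a using free_induction with
    | of i =>
      intro m
      refine ⟨Pi.single i m, ?_⟩
      rw [hΦ, Finset.sum_eq_single i]
      · simp
      · intro j _ hj; simp [hj]
      · simp
    | zero => intro m; simp [cls]
    | add a b ha hb =>
      intro m
      rw [cls, TensorProduct.add_tmul, map_add]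
      exact add_mem (ha m) (hb m)
    | smul t a ha =>
      intro m
      rw [cls, TensorProduct.smul_tmul]
      exact ha _
    | lie a b ha hb =>
      intro m
      rw [cls_lie]
      exact sub_mem (ha _) (hb _)
  have h : c ∈ LinearMap.range Φ := by
    induction c using coker_induction with
    | cls a m => exact hcls a m
    | add a b ha hb => exact add_mem ha hb
  obtain ⟨u, rfl⟩ := h
  exact ⟨u, hΦ u⟩

end Coord

/-! ### The case `λ ≠ 0` -/

section NonZero

universe u v w

variable {K : Type u} [Field K] {n : ℕ} {𝔤 : Type v} [LieRing 𝔤] [LieAlgebra K 𝔤]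
  (g : 𝔤 →ₗ⁅K⁆ DK K n) (V : Type w) [AddCommGroup V] [Module K V] [LieRingModule (Sd g) V]
  [LieModule K (Sd g) V] (lam : K)

/-- The map `v ↦ y ⊗ v ⊗ 1` into `𝓘 ⊗_U (V ⊗ K_λ)`. -/
def tclass (y : L K (n + 1)) : V →ₗ[K] Coker (twist g V lam) :=
  ((bdry (twist g V lam)).mkQ.comp (TensorProduct.mk K _ (V ⊗[K] K) y)).comp
    (TensorProduct.rid K V).symm.toLinearMap

theorem tclass_apply (y : L K (n + 1)) (v : V) :
    tclass g V lam y v = cls (twist g V lam) y (v ⊗ₜ 1) := rfl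

theorem tclass_sum {ι : Type*} (s : Finset ι) (y : ι → L K (n + 1)) (v : V) :
    tclass g V lam (∑ i ∈ s, y i) v = ∑ i ∈ s, tclass g V lam (y i) v := by
  simp only [tclass_apply, cls, TensorProduct.sum_tmul, map_sum]

theorem tclass_neg (y : L K (n + 1)) (v : V) :
    tclass g V lam (-y) v = -tclass g V lam y v := by
  simp only [tclass_apply, cls, TensorProduct.neg_tmul, map_neg]

theorem twist_castSucc_tmul (i : Fin n) (v : V) :
    twist g V lam (x K i.castSucc) (v ⊗ₜ 1) = (actL g V (x K i) v) ⊗ₜ 1 := by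
  have h : x K i.castSucc = freeIncl K n (x K i) := by
    rw [freeIncl, FreeLieAlgebra.lift_of_apply]
  rw [h, twist_incl, LinearMap.rTensor_tmul]

theorem twist_last_tmul (v : V) :
    twist g V lam (x K (Fin.last n)) (v ⊗ₜ 1) = (lam • v) ⊗ₜ 1 := by
  rw [twist_last]; rfl

theorem tmul_one_eq_zero {v : V} : v ⊗ₜ[K] (1 : K) = 0 ↔ v = 0 :=
  (TensorProduct.rid K V).symm.map_eq_zero_iff

theorem twist_pt_zero_tmul (v : V) :
    twist g V lam (pt 0) (v ⊗ₜ 1)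
      = (-(colSum (fun i => actL g V (x K i)) (fun _ => v) + lam • v)) ⊗ₜ 1 := by
  have hpt : (pt 0 : L K (n + 1)) = -∑ k, x K k := rfl
  rw [hpt, map_neg, map_sum, LinearMap.neg_apply, LinearMap.sum_apply, Fin.sum_univ_castSucc,
    twist_last_tmul, colSum_apply, TensorProduct.neg_tmul, TensorProduct.add_tmul,
    TensorProduct.sum_tmul]
  simp only [twist_castSucc_tmul]

/-- The isomorphism `V^n → H_1(𝕃_{n+1}, V ⊗ K_λ)`, as a map to `𝓘 ⊗_U (V ⊗ K_λ)`. -/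
def fromTuple : (Fin n → V) →ₗ[K] Coker (twist g V lam) :=
  ∑ i, (tclass g V lam (x K i.castSucc)).comp (LinearMap.proj i)
    - lam⁻¹ • (tclass g V lam (x K (Fin.last n))).comp (colSum fun i => actL g V (x K i))

theorem fromTuple_apply (w : Fin n → V) :
    fromTuple g V lam w = ∑ i, tclass g V lam (x K i.castSucc) (w i)
      - lam⁻¹ • tclass g V lam (x K (Fin.last n)) (colSum (fun i => actL g V (x K i)) w) := by
  simp [fromTuple]

variable {lam}

theorem fromTuple_mem (h : lam ≠ 0) (w : Fin n → V) :
    fromTuple g V lam w ∈ H1 (twist g V lam) := by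
  change d1bar _ _ = 0
  rw [fromTuple_apply, map_sub, map_sum, map_smul]
  simp only [tclass_apply, d1bar_cls, twist_castSucc_tmul, twist_last_tmul]
  rw [TensorProduct.smul_tmul', inv_smul_smul₀ h, colSum_apply, TensorProduct.sum_tmul, sub_self]

/-- For a cycle `∑ x_k ⊗ v_k` one has `∑ A_i v_i + λ v_{n+1} = 0`, the sum running over `i ≤ n`. As
`λ` is invertible, the last coordinate is determined by the others. -/
theorem exists_fromTuple_eq (h : lam ≠ 0) (c : Coker (twist g V lam))
    (hc : c ∈ H1 (twist g V lam)) : ∃ w, fromTuple g V lam w = c := by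
  obtain ⟨u, rfl⟩ := exists_eq_sum_cls _ c
  obtain ⟨v, rfl⟩ : ∃ v : Fin (n + 1) → V, u = fun k => v k ⊗ₜ 1 :=
    ⟨fun k => TensorProduct.rid K V (u k), funext fun k =>
      ((TensorProduct.rid K V).symm_apply_apply (u k)).symm⟩
  have hc : d1bar (twist g V lam) (∑ k, cls _ (x K k) (v k ⊗ₜ 1)) = 0 := hc
  rw [map_sum, Fin.sum_univ_castSucc] at hc
  simp only [d1bar_cls, twist_castSucc_tmul, twist_last_tmul] at hc
  rw [← TensorProduct.sum_tmul, ← TensorProduct.add_tmul, tmul_one_eq_zero] at hc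
  refine ⟨fun i => v i.castSucc, ?_⟩
  rw [fromTuple_apply, Fin.sum_univ_castSucc, sub_eq_add_neg, ← smul_neg, ← map_neg, ← map_smul,
    colSum_apply, ← eq_neg_of_add_eq_zero_right hc, inv_smul_smul₀ h]
  rfl

/-! ### The action of `x_1, …, x_n` in tuple coordinates -/

theorem thetaId_inL_x (j : Fin n) :
    thetaId g (inL g (x K j)) = thetaGen K j.castSucc (Fin.last n) := by
  change theta K (n + 1) (freeToDK K n (x K j) + dkIncl K n (g 0)) = _
  rw [map_zero, map_zero, add_zero, freeToDK, FreeLieAlgebra.lift_of_apply, theta_A]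

theorem thetaId_x_castSucc (i j : Fin n) :
    thetaId g (inL g (x K j)) (x K i.castSucc)
      = if j = i then ⁅x K j.castSucc, x K (Fin.last n)⁆ else 0 := by
  rw [thetaId_inL_x, thetaGen_x, if_neg (Fin.castSucc_ne_last i).symm]
  simp only [Fin.castSucc_inj]

theorem thetaId_x_last (j : Fin n) :
    thetaId g (inL g (x K j)) (x K (Fin.last n)) = ⁅x K (Fin.last n), x K j.castSucc⁆ := by
  rw [thetaId_inL_x, thetaGen_x, if_neg (Fin.castSucc_ne_last j), if_pos rfl]

/-- Elements of `𝕃_n` move only the left tensor factor, because `gAct` sees only the `𝔤`-component.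
-/
theorem cokerRep_tclass (a : L K n) (y : L K (n + 1)) (v : V) :
    cokerRep (twist g V lam) (thetaId g) (gAct g V) (gAct_twist g V lam) (inL g a)
      (tclass g V lam y v) = tclass g V lam (thetaId g (inL g a) y) v := by
  have h : gAct g V (inL g a) = 0 := by
    apply TensorProduct.ext'
    intro v t
    rw [gAct, tensorRep_tmul]
    simp
  rw [tclass_apply, cokerRep_cls, h, LinearMap.zero_apply, cls, cls, TensorProduct.tmul_zero,
    map_zero, add_zero]
  rfl

theorem tclass_lie (i : Fin n) (v : V) :
    tclass g V lam ⁅x K i.castSucc, x K (Fin.last n)⁆ v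
      = lam • tclass g V lam (x K i.castSucc) v
        - tclass g V lam (x K (Fin.last n)) (actL g V (x K i) v) := by
  rw [tclass_apply, cls_lie, twist_castSucc_tmul, twist_last_tmul, ← tclass_apply, ← tclass_apply,
    map_smul]

/-- The derivation attached to `A_{j,n+1}` sends `x_j` to `[x_j, x_{n+1}]`, `x_{n+1}` to its
negative, and the other generators to `0`. So both sides equal `[x_j, x_{n+1}] ⊗ (w_j + λ⁻¹ ∑ A_i
w_i)`. -/
theorem fromTuple_convOp (h : lam ≠ 0) (j : Fin n) (w : Fin n → V) :
    fromTuple g V lam (convOp (fun i => actL g V (x K i)) lam j w)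
      = cokerRep (twist g V lam) (thetaId g) (gAct g V) (gAct_twist g V lam) (inL g (x K j))
        (fromTuple g V lam w) := by
  -- The cycle `x_j ⊗ v - λ⁻¹ x_{n+1} ⊗ A_j v` is a multiple of a bracket because `x_{n+1}` acts as
  -- `λ`.
  have h1 : ∀ v, fromTuple g V lam (Pi.single j v)
      = lam⁻¹ • tclass g V lam ⁅x K j.castSucc, x K (Fin.last n)⁆ v := by
    intro v
    rw [fromTuple_apply, colSum_single, tclass_lie, smul_sub, inv_smul_smul₀ h,
      Finset.sum_eq_single j]
    · rw [Pi.single_eq_same]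
    · intro i _ hi; rw [Pi.single_eq_of_ne hi, map_zero]
    · simp
  have h2 : ∀ v, tclass g V lam (thetaId g (inL g (x K j)) (x K (Fin.last n))) v
      = - tclass g V lam ⁅x K j.castSucc, x K (Fin.last n)⁆ v := by
    intro v
    rw [thetaId_x_last, ← lie_skew, tclass_neg]
  have h0 : ∀ v, tclass g V lam 0 v = 0 := fun v => by simp [tclass_apply, cls]
  rw [convOp_apply, h1, convRow_apply, map_add, map_smul, smul_add, inv_smul_smul₀ h,
    fromTuple_apply, map_sub, map_sum, map_smul, cokerRep_tclass, h2, smul_neg, sub_neg_eq_add,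
    Finset.sum_eq_single j]
  · rw [cokerRep_tclass, thetaId_x_castSucc, if_pos rfl]
  · intro i _ hi
    rw [cokerRep_tclass, thetaId_x_castSucc, if_neg hi.symm, h0]
  · simp

/-! ### Identification of `mcSub` with `convKer` -/

theorem coord_fromTuple (w : Fin n → V) (i : Fin n) :
    TensorProduct.rid K V (coord (twist g V lam) (fromTuple g V lam w) i.castSucc) = w i := by
  have h : ∀ k v, coord (twist g V lam) (tclass g V lam (x K k) v) = Pi.single k (v ⊗ₜ 1) :=
    fun k v => coord_cls_of _ k _
  rw [fromTuple_apply, map_sub, map_sum, map_smul, h]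
  simp only [h]
  rw [Pi.sub_apply, Pi.smul_apply, Pi.single_eq_of_ne (Fin.castSucc_ne_last i), smul_zero,
    sub_zero, Finset.sum_apply, Finset.sum_eq_single i]
  · rw [Pi.single_eq_same, TensorProduct.rid_tmul, one_smul]
  · intro j _ hj
    rw [Pi.single_eq_of_ne fun h => hj (Fin.castSucc_injective n h).symm]
  · simp

theorem tclass_pt_mem (i : Fin (n + 1)) (v : V) (hv : twist g V lam (pt i) (v ⊗ₜ 1) = 0) :
    tclass g V lam (pt i) v ∈ (mcSub g V lam).map (H1 (twist g V lam)).subtype := by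
  have hmem : tclass g V lam (pt i) v ∈ H1 (twist g V lam) := hv
  refine ⟨⟨_, hmem⟩, Submodule.mem_iSup_of_mem i ?_, rfl⟩
  rw [mem_range_H1map]
  exact ⟨_, hv, rfl⟩

/-- Put `s = ∑ A_i w_i`. The conditions `λ A_j w_j + A_j s = 0` make the correction `w_j + λ⁻¹ s` a
vector killed by `x_j`; summed over `j` they say that `x_0` kills `s`. -/
theorem fromTuple_mem_mcSub (h : lam ≠ 0) (w : Fin n → V)
    (hw : w ∈ convKer (fun i => actL g V (x K i)) lam) :
    fromTuple g V lam w ∈ (mcSub g V lam).map (H1 (twist g V lam)).subtype := by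
  set A := fun i => actL g V (x K i) with hA
  set s := colSum A w with hs
  rw [mem_convKer] at hw
  have hw' : ∀ j, lam • A j (w j) + A j s = 0 := fun j => by
    rw [← map_smul, ← map_add]; exact hw j
  have hs0 : colSum A (fun _ => s) + lam • s = 0 := by
    rw [hs, colSum_apply A w, Finset.smul_sum, ← colSum_apply A w, ← hs, colSum_apply, add_comm,
      ← Finset.sum_add_distrib]
    exact Finset.sum_eq_zero fun j _ => hw' j
  have hk : ∀ j, A j (w j + lam⁻¹ • s) = 0 := fun j => by
    have h1 := congrArg (fun u => lam⁻¹ • u) (hw' j)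
    simpa [smul_add, inv_smul_smul₀ h] using h1
  -- Since `x_0 = -∑ x_k`, the term `λ⁻¹ x_0 ⊗ s` supplies the `x_{n+1}`-part of the cycle and
  -- cancels the shifts by `λ⁻¹ s`.
  have hsum : fromTuple g V lam w
      = ∑ i, tclass g V lam (pt i.succ) (w i + lam⁻¹ • s) + lam⁻¹ • tclass g V lam (pt 0) s := by
    have hpt : (pt 0 : L K (n + 1)) = -∑ k, x K k := rfl
    have hpt' : ∀ i : Fin n, (pt i.succ : L K (n + 1)) = x K i.castSucc := fun i => rfl
    rw [fromTuple_apply, hpt, tclass_neg, tclass_sum, Fin.sum_univ_castSucc]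
    simp only [hpt', map_add, map_smul, Finset.sum_add_distrib, ← Finset.smul_sum, smul_add,
      smul_neg, ← hA, ← hs]
    abel
  rw [hsum]
  refine add_mem (sum_mem fun i _ => tclass_pt_mem g V _ _ ?_)
    (Submodule.smul_mem _ _ (tclass_pt_mem g V _ _ ?_))
  · change twist g V lam (x K i.castSucc) _ = 0
    rw [twist_castSucc_tmul, tmul_one_eq_zero]
    exact hk i
  · rw [twist_pt_zero_tmul, tmul_one_eq_zero, neg_eq_zero]
    exact hs0

/-- It suffices to treat the spanning cycles. For `i ≤ n`, `x_i ⊗ v` with `A_i v = 0` has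
coordinates `v e_i`, and `φ_j(v e_i)` is `λ v` or `0`. The cycle `x_0 ⊗ v` has coordinates `-(v, …,
v)`, on which every `φ_j` vanishes, because `x_0 v = 0` means `∑ A_i v + λ v = 0`. -/
theorem coord_mem_convKer (c : H1 (twist g V lam)) (hc : c ∈ mcSub g V lam) :
    (fun i : Fin n => TensorProduct.rid K V (coord (twist g V lam) c i.castSucc))
      ∈ convKer (fun i => actL g V (x K i)) lam := by
  have h : ∀ k v, coord (twist g V lam) (tclass g V lam (x K k) v) = Pi.single k (v ⊗ₜ 1) :=
    fun k v => coord_cls_of _ k _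
  let Ψ : H1 (twist g V lam) →ₗ[K] (Fin n → V) :=
    LinearMap.pi fun i => (TensorProduct.rid K V).toLinearMap.comp
      ((LinearMap.proj i.castSucc).comp ((coord (twist g V lam)).comp (Submodule.subtype _)))
  suffices hle : mcSub g V lam ≤ (convKer (fun i => actL g V (x K i)) lam).comap Ψ from hle hc
  refine iSup_le fun i c hc => ?_
  obtain ⟨m, hm, hcm⟩ := (mem_range_H1map _ _ _).1 hc
  obtain ⟨v, rfl⟩ : ∃ v : V, m = v ⊗ₜ 1 :=
    ⟨TensorProduct.rid K V m, ((TensorProduct.rid K V).symm_apply_apply m).symm⟩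
  rw [← tclass_apply] at hcm
  have hΨ : ∀ j, Ψ c j = TensorProduct.rid K V
      (coord (twist g V lam) (tclass g V lam (pt i) v) j.castSucc) := fun j => by
    rw [← hcm]; rfl
  rw [Submodule.mem_comap, mem_convKer]
  cases i using Fin.cases with
  | zero =>
    have hpt : (pt 0 : L K (n + 1)) = -∑ k, x K k := rfl
    have hv : Ψ c = -fun _ => v := by
      funext j
      rw [hΨ, hpt, tclass_neg, tclass_sum, map_neg, map_sum, Pi.neg_apply, Finset.sum_apply,
        Finset.sum_eq_single j.castSucc]
      · rw [h, Pi.single_eq_same, map_neg, TensorProduct.rid_tmul, one_smul]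
        rfl
      · intro k _ hk
        rw [h, Pi.single_eq_of_ne hk.symm]
      · simp
    rw [twist_pt_zero_tmul, tmul_one_eq_zero, neg_eq_zero] at hm
    intro j
    rw [hv, map_neg, convRow_apply, add_comm, hm, neg_zero, map_zero]
  | succ i =>
    have hpt : (pt i.succ : L K (n + 1)) = x K i.castSucc := rfl
    have hv : Ψ c = Pi.single i v := by
      funext j
      rw [hΨ, hpt, h]
      by_cases hj : j = i
      · subst hj
        rw [Pi.single_eq_same, Pi.single_eq_same, TensorProduct.rid_tmul, one_smul]
      · rw [Pi.single_eq_of_ne hj, Pi.single_eq_of_ne fun h => hj (Fin.castSucc_injective n h),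
          map_zero]
    rw [hpt, twist_castSucc_tmul, tmul_one_eq_zero] at hm
    intro j
    rw [hv, convRow_single, hm, add_zero]
    split_ifs with hj
    · rw [hj, map_smul, hm, smul_zero]
    · rw [map_zero]

theorem mcNonzero_isIrreducible_iff (hn : 1 ≤ n) (h : lam ≠ 0)
    (V : LieMod.{u, max u v, w} K (Sd g)) (hV : CondStar g V) (hV' : CondStarStar g V) :
    (V.res (inL g)).IsIrreducible ↔
      ((mcNonzero g V.carrier lam).res (inL g)).IsIrreducible := by
  have : Nonempty (Fin n) := ⟨⟨0, hn⟩⟩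
  let Φ : (Fin n → V.carrier) →ₗ[K] H1 (twist g V.carrier lam) :=
    (fromTuple g V.carrier lam).codRestrict _ (fromTuple_mem g V.carrier h)
  have hΦ : Function.Surjective Φ := fun c => by
    obtain ⟨w, hw⟩ := exists_fromTuple_eq g V.carrier h c c.2
    exact ⟨w, Subtype.ext hw⟩
  -- The two inclusions between `mcSub` and `convKer`, transported to `V^n`; `coord_fromTuple`
  -- recovers the tuple from its cycle.
  have hker : LinearMap.ker ((mcSub g V.carrier lam).mkQ.comp Φ)
      = convKer (fun i => actL g V.carrier (x K i)) lam := by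
    rw [LinearMap.ker_comp, Submodule.ker_mkQ]
    ext w
    rw [Submodule.mem_comap]
    refine ⟨fun hw => ?_, fun hw => ?_⟩
    · have := coord_mem_convKer g V.carrier _ hw
      rwa [show (fun i : Fin n => TensorProduct.rid K V.carrier
        (coord (twist g V.carrier lam) (Φ w) i.castSucc)) = w from
        funext fun i => coord_fromTuple g V.carrier w i] at this
    · obtain ⟨c, hc, hcw⟩ := fromTuple_mem_mcSub g V.carrier h w hw
      rwa [← show c = Φ w from Subtype.ext hcw]
  rw [res_isIrreducible_iff, mcNonzero, ofRep_res_isIrreducible_iff,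
    simpleOver_bot_iff (B := convOp (fun i => actL g V.carrier (x K i)) lam)
      ((mcSub g V.carrier lam).mkQ.comp Φ) ((Submodule.mkQ_surjective _).comp hΦ)
      (fun j w => congrArg (mcSub g V.carrier lam).mkQ
        (Subtype.ext (fromTuple_convOp g V.carrier h j w))), hker]
  exact ⟨simpleOver_convKer lam hV', simpleOver_of_convKer lam hV hV'⟩

end NonZero

end

end MidConv

theorem mainTheorem4 {K : Type*} [Field K] {n : ℕ} (hn : 1 ≤ n)
    {𝔤 : Type*} [LieRing 𝔤] [LieAlgebra K 𝔤] (g : 𝔤 →ₗ⁅K⁆ MidConv.DK K n) (lam : K)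
    (V : MidConv.LieMod K (MidConv.Sd g)) [FiniteDimensional K V.carrier]
    (hV : MidConv.CondStar g V) (hV' : MidConv.CondStarStar g V) :
    ((V.res (MidConv.inL g)).IsIrreducible ↔
      ((MidConv.mc g lam V).res (MidConv.inL g)).IsIrreducible) ∧
    ((V.res (MidConv.inL g)).IsIrreducible ∨
        ((MidConv.mc g lam V).res (MidConv.inL g)).IsIrreducible →
      V.IsIrreducible ∧ (MidConv.mc g lam V).IsIrreducible) := by
  have key : (V.res (MidConv.inL g)).IsIrreducible ↔
      ((MidConv.mc g lam V).res (MidConv.inL g)).IsIrreducible := by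
    by_cases h : lam = 0
    · rw [MidConv.mc, if_pos h]
      exact MidConv.mcZero_isIrreducible_iff g hn V hV'
    · rw [MidConv.mc, if_neg h]
      exact MidConv.mcNonzero_isIrreducible_iff g hn h V hV hV'
  refine ⟨key, fun h => ?_⟩
  have h1 := h.elim id key.2
  exact ⟨h1.of_res, (key.1 h1).of_res⟩
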